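/- Let $N\in\{2,3\}$, $\Omega=\{x\in\mathbb R^N:|x|<1\}$, $\Omega_\tau=\{x\in\mathbb R^N:|x|<\tau\}$, and let $\mathbf n>0$ be a constant with $\mathbf n\neq1$. A real number $k>0$ is a transmission eigenvalue with eigenfunctions $(w,v)\in H^1(\Omega)^2$ if $(w,v)\ne(0,0)$ and $$\Delta w+k^2\mathbf n^2w=0,\quad \Delta v+k^2v=0\ \text{ in }\Omega,\qquad w=v,\quad \partial_\nu w=\partial_\nu v\ \text{ on }\partial\Omega,$$ the equations being understood weakly and the boundary conditions in the sense of traces. (a) For every $\tau\in(0,1)$ there are transmission eigenvalues $k_m$ with eigenfunctions $(w_m,v_m)$, $m\in\mathbb N$, such that $$k_m\to\infty\quad\text{and}\quad \lim_{m\to\infty}\frac{\|w_m\|_{L^2(\Omega_\tau)}}{\|w_m\|_{L^2(\Omega)}}=0,\qquad \lim_{m\to\infty}\frac{\|v_m\|_{L^2(\Omega_\tau)}}{\|v_m\|_{L^2(\Omega)}}=0 ,$$ where the denominators are nonzero for all large $m$. (b) Such eigenfunctions can be taken explicitly. Let $\mu=m$ if $N=2$ and $\mu=m+\tfrac12$ if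 $N=3$. Let $J_\mu$ be the Bessel function of the first kind, $j_{\mu,s}$ its $s$-th positive zero, $j_m(t)=\sqrt{\pi/(2t)}\,J_{m+1/2}(t)$, and $$f_\mu(k)=J_{\mu-1}(k)J_\mu(k\mathbf n)-\mathbf nJ_\mu(k)J_{\mu-1}(k\mathbf n).$$ For every integer $s_0\ge1$ there is $m_0$ (depending only on $N$, $\mathbf n$ and $s_0$) such that for every $m>m_0$ the function $f_\mu$ has a zero $k$ with $$\frac{j_{\mu,s_0}}{\max(\mathbf n,1)}<k<\frac{j_{\mu,s_0+1}}{\max(\mathbf n,1)} .$$ Moreover, for every choice of such zeros $k_m$ $(m>m_0)$, the following pairs $(w_m,v_m)$ are transmission eigenfunctions for the eigenvalue $k_m$ for all $m>m_0$, one has $k_m\to\infty$, and the two limits in (a) hold for every $\tau\in(0,1)$, with nonzero denominators for all large $m$: $$N=2:\quad w_m=J_m(k_m\mathbf nr)e^{\mathrm im\theta},\qquad v_m=\frac{J_m(k_m\mathbf n)}{J_m(k_m)}J_m(k_mr)e^{\mathrm im\theta},\qquad x=(r\cos\theta,r\sin\theta);$$ $$N=3:\quad w_m=j_m(k_m\mathbf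 nr)\,Y_m(x/r),\qquad v_m=\frac{j_m(k_m\mathbf n)}{j_m(k_m)}\,j_m(k_mr)\,Y_m(x/r),\qquad r=|x|,$$ where the $Y_m$ are arbitrary nonzero spherical harmonics of degree $m$ (restrictions to the unit sphere of harmonic homogeneous polynomials of degree $m$). -/

import Mathlib

open MeasureTheory Filter Topology Set

open scoped ContDiff

noncomputable section

namespace Transmission

/-- The Euclidean space `ℝ^N`. -/
abbrev E (N : ℕ) : Type := EuclideanSpace ℝ (Fin N)

/-- The open ball `Ω_τ = {x ∈ ℝ^N : |x| < τ}`; the unit ball `Ω` is `Om N 1`. -/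
def Om (N : ℕ) (τ : ℝ) : Set (E N) := Metric.ball 0 τ

/-- The `i`-th classical partial derivative. -/
def partialDeriv {N : ℕ} (i : Fin N) (φ : E N → ℂ) (x : E N) : ℂ :=
  fderiv ℝ φ x (EuclideanSpace.single i 1)

/-- Test functions on `U`: the space `C_c^∞(U)` of complex-valued functions. -/
structure IsTestFunction {N : ℕ} (U : Set (E N)) (φ : E N → ℂ) : Prop where
  smooth : ContDiff ℝ ∞ φ
  compact : HasCompactSupport φ
  subset : tsupport φ ⊆ U

/-- `g` is the `i`-th weak partial derivative of `u` on `U`. -/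
def IsWeakPartial {N : ℕ} (U : Set (E N)) (i : Fin N) (u g : E N → ℂ) : Prop :=
  ∀ φ : E N → ℂ, IsTestFunction U φ →
    ∫ x in U, u x * partialDeriv i φ x = - ∫ x in U, g x * φ x

/-- `u ∈ H¹(U)` with weak gradient `G`. -/
structure IsH1 {N : ℕ} (U : Set (E N)) (u : E N → ℂ) (G : Fin N → E N → ℂ) : Prop where
  memL2 : MemLp u 2 (volume.restrict U)
  grad_memL2 : ∀ i, MemLp (G i) 2 (volume.restrict U)
  weak : ∀ i, IsWeakPartial U i u (G i)

/-- `u ∈ H₀¹(U)` with weak gradient `G`: the pair `(u, G)` is the limit in `L²(U)` of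
`(φ_j, ∇φ_j)` for test functions `φ_j ∈ C_c^∞(U)`. On the unit ball this says that the trace of
`u` on the boundary vanishes. -/
def IsH10 {N : ℕ} (U : Set (E N)) (u : E N → ℂ) (G : Fin N → E N → ℂ) : Prop :=
  IsH1 U u G ∧ ∃ φ : ℕ → E N → ℂ, (∀ j, IsTestFunction U (φ j)) ∧
    Tendsto (fun j => eLpNorm (fun x => u x - φ j x) 2 (volume.restrict U)) atTop (𝓝 0) ∧
    ∀ i, Tendsto (fun j => eLpNorm (fun x => G i x - partialDeriv i (φ j) x) 2
      (volume.restrict U)) atTop (𝓝 0)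

/-- `Δu + κ² u = 0` weakly in `U`, where `G` is the weak gradient of `u`. -/
def WeakHelmholtz {N : ℕ} (U : Set (E N)) (κ : ℝ) (u : E N → ℂ) (G : Fin N → E N → ℂ) : Prop :=
  ∀ φ : E N → ℂ, IsTestFunction U φ →
    ∫ x in U, ((∑ i, G i x * partialDeriv i φ x) - (κ : ℂ) ^ 2 * (u x * φ x)) = 0

/-- `(w, v)` is a pair of transmission eigenfunctions on `U` for the (positive) eigenvalue `k` and
the constant refractive index `n`: `w, v ∈ H¹(U)`, not both zero, with
`Δw + k²n²w = 0` and `Δv + k²v = 0` in `U`, `w = v` on `∂U` (in the sense of traces: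
`w - v ∈ H₀¹(U)`), and `∂_ν w = ∂_ν v` on `∂U` (equality of the functionals
`⟨∂_ν u, φ⟩ = ∫_U (∇u · ∇φ + (Δu) φ)`, `φ ∈ H¹(U)`, for `u = w` and `u = v`). -/
def IsEigenpair {N : ℕ} (U : Set (E N)) (n k : ℝ) (w v : E N → ℂ) : Prop :=
  0 < k ∧ ∃ Gw Gv : Fin N → E N → ℂ,
    IsH1 U w Gw ∧ IsH1 U v Gv ∧
    WeakHelmholtz U (k * n) w Gw ∧ WeakHelmholtz U k v Gv ∧
    IsH10 U (fun x => w x - v x) (fun i x => Gw i x - Gv i x) ∧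
    (∀ (φ : E N → ℂ) (Gφ : Fin N → E N → ℂ), IsH1 U φ Gφ →
      ∫ x in U, ((∑ i, Gw i x * Gφ i x) - ((k * n : ℝ) : ℂ) ^ 2 * (w x * φ x)) =
      ∫ x in U, ((∑ i, Gv i x * Gφ i x) - (k : ℂ) ^ 2 * (v x * φ x))) ∧
    ¬ ((∀ᵐ x ∂(volume.restrict U), w x = 0) ∧ (∀ᵐ x ∂(volume.restrict U), v x = 0))

/-- The `L²(Ω_τ)` norm. -/
def l2norm {N : ℕ} (τ : ℝ) (ψ : E N → ℂ) : ℝ :=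
  (eLpNorm ψ 2 (volume.restrict (Om N τ))).toReal

/-- `‖ψ_m‖_{L²(Ω_τ)} / ‖ψ_m‖_{L²(Ω)} → 0` as `m → ∞`, where (eventually) the functions `ψ_m` are
nonzero elements of `L²(Ω)`, so that the quotient is meaningful. -/
def Localizes {N : ℕ} (τ : ℝ) (ψ : ℕ → E N → ℂ) : Prop :=
  (∀ᶠ m in atTop, MemLp (ψ m) 2 (volume.restrict (Om N 1)) ∧ 0 < l2norm 1 (ψ m)) ∧
  Tendsto (fun m => l2norm τ (ψ m) / l2norm 1 (ψ m)) atTop (𝓝 0)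

/-- The Bessel function of the first kind `J_ν(t)`, of order `ν ≥ 0` and for `t ≥ 0`. -/
def besselJ (ν t : ℝ) : ℝ :=
  ∑' j : ℕ, (-1) ^ j / ((j.factorial : ℝ) * Real.Gamma (ν + j + 1)) *
    (t / 2) ^ (ν + 2 * (j : ℝ))

/-- For `s ≥ 1`, `besselZero ν s = j_{ν,s}` is the `s`-th positive zero of `J_ν`, in increasing
order (and `besselZero ν 0 = 0`). -/
def besselZero (ν : ℝ) : ℕ → ℝ
  | 0 => 0
  | s + 1 => sInf {t : ℝ | besselZero ν s < t ∧ besselJ ν t = 0}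

/-- `f_ν(k) = J_{ν-1}(k) J_ν(k n) - n J_ν(k) J_{ν-1}(k n)`. -/
def charFun (n ν k : ℝ) : ℝ :=
  besselJ (ν - 1) k * besselJ ν (k * n) - n * besselJ ν k * besselJ (ν - 1) (k * n)

/-- `k` is a zero of `f_ν` lying strictly between `j_{ν,s} / max(n,1)` and
`j_{ν,s+1} / max(n,1)`. -/
def IsModeZero (n ν : ℝ) (s : ℕ) (k : ℝ) : Prop :=
  k ∈ Ioo (besselZero ν s / max n 1) (besselZero ν (s + 1) / max n 1) ∧ charFun n ν k = 0

/-- The planar separated mode `J_m(κ r) e^{imθ}`, `x = (r cos θ, r sin θ)`. -/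
def planarMode (m : ℕ) (κ : ℝ) (x : E 2) : ℂ :=
  (besselJ m (κ * ‖x‖) : ℂ) *
    Complex.exp (Complex.I * m * ((⟨x 0, x 1⟩ : ℂ).arg : ℂ))

/-- The spherical Bessel function `j_m(t) = √(π / (2t)) J_{m+1/2}(t)`, `t > 0`
(for `m ≥ 1` the value at `t = 0` is `0`, as it should be). -/
def sphericalBessel (m : ℕ) (t : ℝ) : ℝ :=
  Real.sqrt (Real.pi / (2 * t)) * besselJ (m + 1 / 2) t

/-- `Y` is a spherical harmonic of degree `m` on the unit sphere of `ℝ³`: the restriction to the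
sphere of a harmonic homogeneous polynomial of degree `m`. -/
def IsSphericalHarmonic (m : ℕ) (Y : E 3 → ℂ) : Prop :=
  ∃ P : MvPolynomial (Fin 3) ℂ, P.IsHomogeneous m ∧
    ∑ i, MvPolynomial.pderiv i (MvPolynomial.pderiv i P) = 0 ∧
    ∀ x ∈ Metric.sphere (0 : E 3) 1, Y x = MvPolynomial.eval (fun i => (x i : ℂ)) P

/-- The spatial separated mode `j_m(κ r) Y(x / r)`, `r = |x|`. -/
def spatialMode (m : ℕ) (κ : ℝ) (Y : E 3 → ℂ) (x : E 3) : ℂ :=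
  (sphericalBessel m (κ * ‖x‖) : ℂ) * Y (‖x‖⁻¹ • x)

/-- The planar mode `w = J_m(k n r) e^{imθ}`. -/
def w2 (n : ℝ) (m : ℕ) (k : ℝ) : E 2 → ℂ := planarMode m (k * n)

/-- The planar mode `v = β J_m(k r) e^{imθ}`, `β = J_m(k n) / J_m(k)`. -/
def v2 (n : ℝ) (m : ℕ) (k : ℝ) : E 2 → ℂ := fun x =>
  ((besselJ m (k * n) / besselJ m k : ℝ) : ℂ) * planarMode m k x

/-- The spatial mode `w = j_m(k n r) Y(x / r)`. -/
def w3 (n : ℝ) (m : ℕ) (k : ℝ) (Y : E 3 → ℂ) : E 3 → ℂ := spatialMode m (k * n) Y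

/-- The spatial mode `v = β j_m(k r) Y(x / r)`, `β = j_m(k n) / j_m(k)`. -/
def v3 (n : ℝ) (m : ℕ) (k : ℝ) (Y : E 3 → ℂ) : E 3 → ℂ := fun x =>
  ((sphericalBessel m (k * n) / sphericalBessel m k : ℝ) : ℂ) * spatialMode m k Y x

end Transmission

end

/-!
The eigenfunctions are separated modes. Write `J_ν(t) = (t / 2)^ν F_ν(t² / 4)` with the entire
function `F_ν` (`besselEntire`). For a harmonic homogeneous polynomial `P` of degree `m` on `ℝ^N`
and `ν = m + N / 2 - 1`, the function `P(x) F_ν(κ² |x|² / 4)` (`mode`) is smooth on all of `ℝ^N` and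
solves the Helmholtz equation with wave number `κ` (`laplacian_mode`); the planar and the spatial
modes of the theorem are of this form, so that both dimensions are treated at once
(`exists_forall_mode_family`).

*Eigenfunctions.* At a zero of the characteristic function, the two modes agree on the unit sphere
together with all first derivatives (`besselEntire_matching`). Hence `w - v` and `∇(w - v)` are
smooth and vanish on the sphere, and multiplication by cutoffs `χ_j` shows both that `w - v` lies in
`H₀¹` and that the conormal functionals of `w` and `v` agree on all of `H¹`
(`isEigenpair_of_contDiff`).

*Zeros.* Before the turning point, `J_ν > 0` on `(0, ν]` (`besselJ_pos`). After it, a Sturm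
comparison in the variable `log t` gives `j_{ν,s} < Q ν` for every `Q > 1`, fixed `s` and large `ν`
(`eventually_besselZero_lt`), and a monotone energy shows that zeros are simple
(`besselD_ne_zero`). So at the ends of the interval in question one term of the characteristic
function vanishes, while the other is a product of a factor of constant sign and of
`J_{ν-1}(j_{ν,s}) = J_ν'(j_{ν,s})`, which alternates in sign with `s`: there is a zero in between
(`exists_isModeZero`).

*Localization.* The wave numbers `k` and `k n` are at most `(1 + o(1)) ν`. Thus on the ball of
radius `τ < 1` the argument of the Bessel function stays below a fixed fraction of the turning
point, where `|J_ν(l t)| ≥ l^{c ν} |J_ν(t)|` for some `c > 0` and `l > 1`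
(`rpow_mul_abs_besselJ_le`). The modes therefore grow pointwise by an exponentially large factor
under the dilation `x ↦ l x`, and the change of variables `x ↦ l x` turns this into the decay of the
quotient of `L²` norms (`localizes_of_dilation`), without polar coordinates.
-/

namespace Transmission

/-! ### The entire part of the Bessel function -/

/-- The Taylor coefficients of `besselEntire ν`. -/
noncomputable def besselCoeff (ν : ℝ) (j : ℕ) : ℝ :=
  (-1) ^ j / ((j.factorial : ℝ) * Real.Gamma (ν + j + 1))

/-- The entire function `F_ν(z) = ∑ (-z)^j / (j! Γ(ν + j + 1))`, normalized so that
`J_ν(t) = (t / 2)^ν F_ν(t² / 4)`. It carries all the analysis at the origin. -/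
noncomputable def besselEntire (ν z : ℝ) : ℝ := ∑' j : ℕ, besselCoeff ν j * z ^ j

lemma Gamma_le_Gamma_add_nat {ν : ℝ} (hν : 0 ≤ ν) (j : ℕ) :
    Real.Gamma (ν + 1) ≤ Real.Gamma (ν + j + 1) := by
  induction j with
  | zero => simp
  | succ j ih =>
    have h : Real.Gamma (ν + (j + 1 : ℕ) + 1) = (ν + j + 1) * Real.Gamma (ν + j + 1) := by
      rw [← Real.Gamma_add_one (by positivity)]
      push_cast
      ring_nf
    have hpos : 0 < Real.Gamma (ν + j + 1) := Real.Gamma_pos_of_pos (by positivity)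
    rw [h]
    have : (0 : ℝ) ≤ ν + j := by positivity
    nlinarith

lemma abs_besselCoeff_le {ν : ℝ} (hν : 0 ≤ ν) (j : ℕ) :
    |besselCoeff ν j| ≤ (Real.Gamma (ν + 1))⁻¹ / j.factorial := by
  have h0 : 0 < Real.Gamma (ν + 1) := Real.Gamma_pos_of_pos (by positivity)
  have h1 := Gamma_le_Gamma_add_nat hν j
  have h2 : 0 < Real.Gamma (ν + j + 1) := h0.trans_le h1
  have hf : (0 : ℝ) < j.factorial := by positivity
  rw [besselCoeff, abs_div, abs_pow, abs_neg, abs_one, one_pow, abs_of_pos (by positivity),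
    div_eq_mul_inv, div_eq_mul_inv, mul_inv, one_mul, mul_comm]
  gcongr

lemma summable_besselCoeff {ν : ℝ} (hν : 0 ≤ ν) (z : ℝ) :
    Summable fun j => besselCoeff ν j * z ^ j := by
  refine Summable.of_norm_bounded
    ((Real.summable_pow_div_factorial |z|).mul_left (Real.Gamma (ν + 1))⁻¹) fun j => ?_
  rw [norm_mul, norm_pow, Real.norm_eq_abs, Real.norm_eq_abs]
  calc |besselCoeff ν j| * |z| ^ j ≤ (Real.Gamma (ν + 1))⁻¹ / j.factorial * |z| ^ j := by
        gcongr; exact abs_besselCoeff_le hν j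
    _ = _ := by ring

lemma besselCoeff_succ (ν : ℝ) (j : ℕ) :
    besselCoeff ν (j + 1) * (j + 1) = -besselCoeff (ν + 1) j := by
  have h : ν + 1 + (j : ℝ) + 1 = ν + ((j + 1 : ℕ) : ℝ) + 1 := by push_cast; ring
  have h1 : (j : ℝ) + 1 ≠ 0 := by positivity
  rw [besselCoeff, besselCoeff, h, Nat.factorial_succ, pow_succ]
  push_cast
  field_simp

lemma besselCoeff_sub_one {ν : ℝ} (hν : 0 < ν) (j : ℕ) :
    besselCoeff (ν - 1) j = (ν + j) * besselCoeff ν j := by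
  have h : Real.Gamma (ν + j + 1) = (ν + j) * Real.Gamma (ν + j) :=
    Real.Gamma_add_one (by positivity)
  have h1 : Real.Gamma (ν + j) ≠ 0 := (Real.Gamma_pos_of_pos (by positivity)).ne'
  have h2 : ν + j ≠ 0 := by positivity
  rw [besselCoeff, besselCoeff, h, show ν - 1 + (j : ℝ) + 1 = ν + j by ring]
  field_simp

lemma hasDerivAt_besselEntire {ν : ℝ} (hν : 0 ≤ ν) (z : ℝ) :
    HasDerivAt (besselEntire ν) (-besselEntire (ν + 1) z) z := by
  set R : ℝ := |z| + 1
  set C : ℝ := (Real.Gamma (ν + 1))⁻¹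
  have hC : 0 < C := inv_pos.2 (Real.Gamma_pos_of_pos (by positivity))
  have hR : 0 < R := by positivity
  have hzR : z ∈ Metric.ball (0 : ℝ) R := by simp [R]
  have key : HasDerivAt (fun z => ∑' j : ℕ, besselCoeff ν j * z ^ j)
      (∑' j : ℕ, besselCoeff ν j * (j * z ^ (j - 1))) z := by
    refine hasDerivAt_tsum_of_isPreconnected
      (u := fun j : ℕ => C / j.factorial * (j * R ^ (j - 1))) ?_ Metric.isOpen_ball
      (convex_ball (0 : ℝ) R).isPreconnected
      (fun j y _ => (hasDerivAt_pow j y).const_mul _) (fun j y hy => ?_)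
      hzR (summable_besselCoeff hν z) hzR
    · rw [← summable_nat_add_iff 1]
      refine ((Real.summable_pow_div_factorial R).mul_left C).congr fun j => ?_
      have h1 : (j : ℝ) + 1 ≠ 0 := by positivity
      rw [Nat.factorial_succ, Nat.add_sub_cancel]
      push_cast
      field_simp
    · have hy' : |y| ≤ R := by
        have := mem_ball_zero_iff.1 hy
        rw [Real.norm_eq_abs] at this
        exact this.le
      rw [norm_mul, norm_mul, norm_pow, Real.norm_eq_abs, Real.norm_eq_abs, Real.norm_eq_abs,
        Nat.abs_cast]
      gcongr
      exact abs_besselCoeff_le hν j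
  have hs : Summable fun j : ℕ => besselCoeff ν j * (j * z ^ (j - 1)) := by
    rw [← summable_nat_add_iff 1]
    refine (summable_besselCoeff (ν := ν + 1) (by positivity) z).neg.congr fun j => ?_
    have := besselCoeff_succ ν j
    simp only [Nat.add_sub_cancel]
    push_cast
    linear_combination (-z ^ j) * this
  refine key.congr_deriv ?_
  rw [hs.tsum_eq_zero_add, besselEntire, ← tsum_neg]
  simp only [Nat.cast_zero, zero_mul, mul_zero, zero_add]
  refine tsum_congr fun j => ?_
  have := besselCoeff_succ ν j
  simp only [Nat.add_sub_cancel]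
  push_cast
  linear_combination z ^ j * this

lemma besselEntire_sub_one {ν : ℝ} (hν : 1 ≤ ν) (z : ℝ) :
    besselEntire (ν - 1) z = ν * besselEntire ν z - z * besselEntire (ν + 1) z := by
  have h1 := summable_besselCoeff (ν := ν) (by linarith) z
  have h0 := summable_besselCoeff (ν := ν - 1) (by linarith) z
  have h3 : Summable fun j : ℕ => (j : ℝ) * besselCoeff ν j * z ^ j := by
    refine (h0.sub (h1.mul_left ν)).congr fun j => ?_
    rw [besselCoeff_sub_one (by linarith)]
    ring
  have e3 : ∑' j : ℕ, (j : ℝ) * besselCoeff ν j * z ^ j = -(z * besselEntire (ν + 1) z) := by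
    rw [h3.tsum_eq_zero_add, besselEntire, ← tsum_mul_left, ← tsum_neg]
    simp only [Nat.cast_zero, zero_mul, zero_add]
    refine tsum_congr fun j => ?_
    have := besselCoeff_succ ν j
    push_cast
    rw [pow_succ]
    linear_combination (z ^ j * z) * this
  rw [sub_eq_add_neg (ν * _), ← e3, besselEntire, besselEntire, ← tsum_mul_left,
    ← (h1.mul_left ν).tsum_add h3]
  refine tsum_congr fun j => ?_
  rw [besselCoeff_sub_one (by linarith)]
  ring

lemma contDiff_besselEntire {ν : ℝ} (hν : 0 ≤ ν) : ContDiff ℝ ∞ (besselEntire ν) := by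
  refine contDiff_infty.2 fun k => ?_
  induction k generalizing ν with
  | zero =>
    exact contDiff_zero.2
      (continuous_iff_continuousAt.2 fun z => (hasDerivAt_besselEntire hν z).continuousAt)
  | succ k ih =>
    have hd : deriv (besselEntire ν) = fun z => -besselEntire (ν + 1) z :=
      funext fun z => (hasDerivAt_besselEntire hν z).deriv
    have h := (contDiff_succ_iff_deriv (n := ((k : ℕ) : WithTop ℕ∞)) (f := besselEntire ν)).2
      ⟨fun z => (hasDerivAt_besselEntire hν z).differentiableAt, by simp,
        by rw [hd]; exact (ih (by positivity)).neg⟩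
    exact_mod_cast h

lemma besselEntire_zero_pos {ν : ℝ} (hν : 0 ≤ ν) : 0 < besselEntire ν 0 := by
  have h : besselEntire ν 0 = (Real.Gamma (ν + 1))⁻¹ := by
    rw [besselEntire, tsum_eq_single 0 (fun j hj => by simp [hj])]
    simp [besselCoeff]
  rw [h]
  exact inv_pos.2 (Real.Gamma_pos_of_pos (by positivity))

/-! ### Differential equation and recurrences for `J_ν` -/

lemma besselJ_eq {ν t : ℝ} (ht : 0 < t) :
    besselJ ν t = (t / 2) ^ ν * besselEntire ν (t ^ 2 / 4) := by
  rw [besselJ, besselEntire, ← tsum_mul_left]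
  refine tsum_congr fun j => ?_
  have h : (t / 2) ^ (ν + 2 * (j : ℝ)) = (t / 2) ^ ν * (t ^ 2 / 4) ^ j := by
    rw [Real.rpow_add (by positivity),
      show (2 : ℝ) * (j : ℝ) = ((2 * j : ℕ) : ℝ) by push_cast; ring,
      Real.rpow_natCast, pow_mul, div_pow]
    norm_num
  rw [h, besselCoeff]
  ring

lemma besselJ_zero {ν : ℝ} (hν : 0 < ν) : besselJ ν 0 = 0 := by
  rw [besselJ]
  refine (tsum_congr fun j => ?_).trans tsum_zero
  rw [zero_div, Real.zero_rpow (by positivity), mul_zero]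

lemma besselJ_recurrence {ν t : ℝ} (hν : 1 ≤ ν) (ht : 0 < t) :
    t * (besselJ (ν - 1) t + besselJ (ν + 1) t) = 2 * ν * besselJ ν t := by
  rw [besselJ_eq ht, besselJ_eq ht, besselJ_eq ht, besselEntire_sub_one hν,
    Real.rpow_sub_one (by positivity), Real.rpow_add_one (by positivity)]
  field_simp
  ring

lemma hasDerivAt_besselJ {ν t : ℝ} (hν : 0 ≤ ν) (ht : 0 < t) :
    HasDerivAt (besselJ ν) (ν / t * besselJ ν t - besselJ (ν + 1) t) t := by
  have h1 : HasDerivAt (fun t : ℝ => t / 2) (1 / 2) t := (hasDerivAt_id t).div_const 2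
  have h2 : HasDerivAt (fun t : ℝ => t ^ 2 / 4) (t / 2) t := by
    refine ((hasDerivAt_pow 2 t).div_const 4).congr_deriv ?_
    norm_num
    ring
  have h3 := (h1.rpow_const (p := ν) (Or.inl (by positivity))).mul
    ((hasDerivAt_besselEntire hν (t ^ 2 / 4)).comp t h2)
  have h4 : besselJ ν =ᶠ[𝓝 t] fun t => (t / 2) ^ ν * besselEntire ν (t ^ 2 / 4) := by
    filter_upwards [lt_mem_nhds ht] with s hs using besselJ_eq hs
  refine (h3.congr_of_eventuallyEq h4).congr_deriv ?_
  rw [besselJ_eq ht, besselJ_eq ht, Real.rpow_add_one (by positivity),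
    Real.rpow_sub_one (by positivity)]
  simp only [Function.comp]
  field_simp
  ring

/-- The derivative `t J_ν'(t)` of `J_ν` in the variable `log t`, written without derivatives
through the recurrence `t J_ν' = t J_{ν-1} - ν J_ν`. -/
noncomputable def besselD (ν t : ℝ) : ℝ := t * besselJ (ν - 1) t - ν * besselJ ν t

lemma hasDerivAt_besselJ_div {ν t : ℝ} (hν : 1 ≤ ν) (ht : 0 < t) :
    HasDerivAt (besselJ ν) (besselD ν t / t) t := by
  refine (hasDerivAt_besselJ (by linarith) ht).congr_deriv ?_
  have := besselJ_recurrence hν ht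
  rw [besselD]
  field_simp
  linarith

/-- Bessel's equation `t (t J')' = (ν² - t²) J`. -/
lemma hasDerivAt_besselD {ν t : ℝ} (hν : 1 ≤ ν) (ht : 0 < t) :
    HasDerivAt (besselD ν) ((ν ^ 2 - t ^ 2) * besselJ ν t / t) t := by
  have h1 := (hasDerivAt_id t).mul (hasDerivAt_besselJ (ν := ν - 1) (by linarith) ht)
  have h2 := (hasDerivAt_besselJ_div hν ht).const_mul ν
  refine (h1.sub h2).congr_deriv ?_
  simp only [id, sub_add_cancel, besselD]
  field_simp
  ring

lemma continuousOn_besselJ {ν : ℝ} (hν : 1 ≤ ν) : ContinuousOn (besselJ ν) (Ioi 0) :=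
  fun _ ht => (hasDerivAt_besselJ_div hν ht).continuousAt.continuousWithinAt

lemma tendsto_besselJ_zero {ν : ℝ} (hν : 0 < ν) : Tendsto (besselJ ν) (𝓝[>] 0) (𝓝 0) := by
  have h1 : ContinuousAt (fun t : ℝ => (t / 2) ^ ν * besselEntire ν (t ^ 2 / 4)) 0 := by
    refine ContinuousAt.mul ?_ ?_
    · exact (Real.continuousAt_rpow_const _ _ (Or.inr hν.le)).comp
        (continuousAt_id.div_const 2)
    · exact ((contDiff_besselEntire hν.le).continuous.comp (by fun_prop)).continuousAt
  have h2 := h1.tendsto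
  simp only [zero_div] at h2
  rw [Real.zero_rpow hν.ne', zero_mul] at h2
  refine (h2.mono_left nhdsWithin_le_nhds).congr' ?_
  filter_upwards [self_mem_nhdsWithin] with t ht using (besselJ_eq ht).symm

lemma tendsto_besselD_zero {ν : ℝ} (hν : 1 ≤ ν) : Tendsto (besselD ν) (𝓝[>] 0) (𝓝 0) := by
  have h1 : ContinuousAt (fun t : ℝ => t * ((t / 2) ^ (ν - 1) *
      besselEntire (ν - 1) (t ^ 2 / 4))) 0 := by
    refine continuousAt_id.mul (ContinuousAt.mul ?_ ?_)
    · exact (Real.continuousAt_rpow_const _ _ (Or.inr (by linarith))).comp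
        (continuousAt_id.div_const 2)
    · exact ((contDiff_besselEntire (by linarith)).continuous.comp (by fun_prop)).continuousAt
  have h2 := h1.tendsto
  rw [zero_mul] at h2
  have h3 := (h2.mono_left nhdsWithin_le_nhds).congr' (f₂ := fun t => t * besselJ (ν - 1) t) (by
    filter_upwards [self_mem_nhdsWithin] with t ht
    rw [besselJ_eq ht])
  have h4 := h3.sub ((tendsto_besselJ_zero (ν := ν) (by linarith)).const_mul ν)
  rwa [mul_zero, sub_zero] at h4

lemma eventually_besselJ_pos {ν : ℝ} (hν : 0 ≤ ν) : ∀ᶠ t in 𝓝[>] 0, 0 < besselJ ν t := by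
  have h1 : ContinuousAt (fun t : ℝ => besselEntire ν (t ^ 2 / 4)) 0 :=
    ((contDiff_besselEntire hν).continuous.comp (by fun_prop)).continuousAt
  have h2 := h1.eventually (lt_mem_nhds (a := 0) (by simpa using besselEntire_zero_pos hν))
  filter_upwards [nhdsWithin_le_nhds h2, self_mem_nhdsWithin] with t ht ht0
  rw [besselJ_eq ht0]
  have : (0 : ℝ) < t := ht0
  positivity

/-! ### Monotonicity and growth before the turning point -/

/-- A function on `(0, b]` with nonnegative derivative and limit `0` at `0` is nonnegative. -/
lemma nonneg_of_deriv_nonneg_of_tendsto {f f' : ℝ → ℝ} {b : ℝ}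
    (hf : ∀ t, 0 < t → HasDerivAt f (f' t) t) (hf' : ∀ t, 0 < t → t ≤ b → 0 ≤ f' t)
    (h0 : Tendsto f (𝓝[>] 0) (𝓝 0)) {t : ℝ} (ht : 0 < t) (htb : t ≤ b) : 0 ≤ f t := by
  have hmono : MonotoneOn f (Ioc 0 b) := by
    refine monotoneOn_of_hasDerivWithinAt_nonneg (f' := f') (convex_Ioc 0 b)
      (fun x hx => (hf x hx.1).continuousAt.continuousWithinAt)
      (fun x hx => ?_) (fun x hx => ?_)
    · exact (hf x (interior_subset hx).1).hasDerivWithinAt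
    · exact hf' x (interior_subset hx).1 (interior_subset hx).2
  refine le_of_tendsto h0 ?_
  filter_upwards [Ioo_mem_nhdsGT ht] with s hs
  exact hmono ⟨hs.1, hs.2.le.trans htb⟩ ⟨ht, htb⟩ hs.2.le

/-- A continuous function without zeros on a preconnected set does not change sign there. -/
lemma mul_pos_of_forall_ne_zero {f : ℝ → ℝ} {S : Set ℝ} (hS : IsPreconnected S)
    (hf : ContinuousOn f S) (h0 : ∀ t ∈ S, f t ≠ 0) {s t : ℝ} (hs : s ∈ S) (ht : t ∈ S) :
    0 < f s * f t := by
  by_contra! h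
  have key : ∀ {s t : ℝ}, s ∈ S → t ∈ S → f s ≤ 0 → ¬ 0 ≤ f t := fun hs ht h1 h2 => by
    obtain ⟨x, hx, hx0⟩ := hS.intermediate_value hs ht hf ⟨h1, h2⟩
    exact h0 x hx hx0
  rcases mul_nonpos_iff.1 h with ⟨h1, h2⟩ | ⟨h1, h2⟩
  · exact key ht hs h2 h1
  · exact key hs ht h1 h2

/-- Before the turning point `√(ν² - c²)`, the function `|J_ν|` grows at least like `t^c`. With
`D = t J'`, the function `G = D J - c J²` satisfies `t G' = (D - c J)² + (ν² - c² - t²) J² ≥ 0`, so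
it is nonnegative, and `(t^{-2c} J²)' = 2 t^{-2c-1} G`. -/
lemma rpow_mul_abs_besselJ_le {ν c t l : ℝ} (hν : 1 ≤ ν) (ht : 0 < t) (hl : 1 ≤ l)
    (hb : (l * t) ^ 2 + c ^ 2 ≤ ν ^ 2) : l ^ c * |besselJ ν t| ≤ |besselJ ν (l * t)| := by
  have hl0 : 0 < l := by linarith
  have hG : ∀ s, 0 < s → s ≤ l * t →
      0 ≤ besselD ν s * besselJ ν s - c * besselJ ν s ^ 2 := by
    intro s hs hsb
    refine nonneg_of_deriv_nonneg_of_tendsto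
      (f := fun s => besselD ν s * besselJ ν s - c * besselJ ν s ^ 2)
      (f' := fun s => ((besselD ν s - c * besselJ ν s) ^ 2
        + (ν ^ 2 - s ^ 2 - c ^ 2) * besselJ ν s ^ 2) / s) (b := l * t) ?_ ?_ ?_ hs hsb
    · intro s hs
      have hJ := hasDerivAt_besselJ_div hν hs
      refine (((hasDerivAt_besselD hν hs).mul hJ).sub ((hJ.pow 2).const_mul c)).congr_deriv ?_
      field_simp
      norm_num
      ring
    · intro s hs hsb
      have h1 : s ^ 2 ≤ (l * t) ^ 2 := by gcongr
      have h2 : 0 ≤ ν ^ 2 - s ^ 2 - c ^ 2 := by linarith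
      positivity
    · have hD := tendsto_besselD_zero hν
      have hJ := tendsto_besselJ_zero (ν := ν) (by linarith)
      simpa using (hD.mul hJ).sub ((hJ.pow 2).const_mul c)
  have hmono : MonotoneOn (fun s => s ^ (-2 * c) * besselJ ν s ^ 2) (Ioc 0 (l * t)) := by
    have hd : ∀ s, 0 < s → HasDerivAt (fun s => s ^ (-2 * c) * besselJ ν s ^ 2)
        (2 * s ^ (-2 * c - 1) * (besselD ν s * besselJ ν s - c * besselJ ν s ^ 2)) s := by
      intro s hs
      refine ((Real.hasDerivAt_rpow_const (p := -2 * c) (Or.inl hs.ne')).mul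
        ((hasDerivAt_besselJ_div hν hs).pow 2)).congr_deriv ?_
      rw [Real.rpow_sub_one hs.ne']
      field_simp
      norm_num
      ring
    refine monotoneOn_of_hasDerivWithinAt_nonneg (convex_Ioc 0 _)
      (fun s hs => (hd s hs.1).continuousAt.continuousWithinAt)
      (fun s hs => (hd s (interior_subset hs).1).hasDerivWithinAt) (fun s hs => ?_)
    obtain ⟨h1, h2⟩ := interior_subset hs
    have := hG s h1 h2
    positivity
  have h1 := hmono ⟨ht, le_mul_of_one_le_left ht.le hl⟩ ⟨by positivity, le_rfl⟩
    (le_mul_of_one_le_left ht.le hl)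
  simp only at h1
  rw [Real.mul_rpow hl0.le ht.le, mul_right_comm, mul_comm (_ * _)] at h1
  have h2 : besselJ ν t ^ 2 ≤ l ^ (-2 * c) * besselJ ν (l * t) ^ 2 :=
    le_of_mul_le_mul_left h1 (by positivity)
  have h3 : l ^ (-2 * c) = ((l ^ c) ^ 2)⁻¹ := by
    rw [← Real.rpow_natCast, ← Real.rpow_mul hl0.le, ← Real.rpow_neg hl0.le]
    congr 1
    push_cast
    ring
  rw [h3, inv_mul_eq_div, le_div_iff₀ (by positivity), ← mul_pow] at h2
  have h4 := sq_le_sq.1 h2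
  rwa [abs_mul, abs_of_pos (Real.rpow_pos_of_pos hl0 c), mul_comm] at h4

lemma besselJ_pos {ν t : ℝ} (hν : 1 ≤ ν) (ht : 0 < t) (htν : t ≤ ν) : 0 < besselJ ν t := by
  obtain ⟨s, hs, hs0⟩ := ((eventually_besselJ_pos (ν := ν) (by linarith)).and
    (Ioo_mem_nhdsGT ht)).exists
  have hne : ∀ x ∈ Icc s t, besselJ ν x ≠ 0 := by
    intro x hx h0
    have hsx : 1 ≤ x / s := (one_le_div hs0.1).2 hx.1
    have h := rpow_mul_abs_besselJ_le (c := 0) hν hs0.1 hsx (by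
      rw [div_mul_cancel₀ _ hs0.1.ne']
      nlinarith [hx.1, hx.2, hs0.1])
    rw [div_mul_cancel₀ _ hs0.1.ne', h0, Real.rpow_zero, one_mul, abs_zero] at h
    exact absurd h (not_le.2 (abs_pos.2 hs.ne'))
  have := mul_pos_of_forall_ne_zero isPreconnected_Icc
    ((continuousOn_besselJ hν).mono fun x hx => hs0.1.trans_le hx.1) hne
    (left_mem_Icc.2 hs0.2.le) (right_mem_Icc.2 hs0.2.le)
  exact (pos_iff_pos_of_mul_pos this).1 hs

/-! ### Oscillation after the turning point -/

/-- Positive zeros of `J_ν` are simple: the energy `E = D² + (t² - ν²) J²` has `E' = 2 t J² ≥ 0` and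
limit `0` at the origin, so a point with `J = D = 0` would force `J = 0` on an initial interval. -/
lemma besselD_ne_zero {ν t : ℝ} (hν : 1 ≤ ν) (ht : 0 < t) (h0 : besselJ ν t = 0) :
    besselD ν t ≠ 0 := by
  intro hD
  set En : ℝ → ℝ := fun s => besselD ν s ^ 2 + (s ^ 2 - ν ^ 2) * besselJ ν s ^ 2 with hEn
  have hd : ∀ s, 0 < s → HasDerivAt En (2 * s * besselJ ν s ^ 2) s := by
    intro s hs
    refine (((hasDerivAt_besselD hν hs).pow 2).add (((hasDerivAt_pow 2 s).sub_const (ν ^ 2)).mul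
      ((hasDerivAt_besselJ_div hν hs).pow 2))).congr_deriv ?_
    norm_num
    field_simp
    ring
  have hlim : Tendsto En (𝓝[>] 0) (𝓝 0) := by
    have h1 := tendsto_besselD_zero hν
    have h2 := tendsto_besselJ_zero (ν := ν) (by linarith)
    have h3 : Tendsto (fun s : ℝ => s ^ 2 - ν ^ 2) (𝓝[>] 0) (𝓝 (0 ^ 2 - ν ^ 2)) :=
      Tendsto.mono_left (Continuous.tendsto (by fun_prop) 0) nhdsWithin_le_nhds
    simpa using (h1.pow 2).add (h3.mul (h2.pow 2))
  have hnn : ∀ s, 0 < s → 0 ≤ En s := fun s hs =>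
    nonneg_of_deriv_nonneg_of_tendsto (b := s) hd (fun x hx _ => by positivity) hlim hs le_rfl
  have hmono : MonotoneOn En (Ioi 0) := by
    refine monotoneOn_of_hasDerivWithinAt_nonneg (f' := fun s => 2 * s * besselJ ν s ^ 2)
      (convex_Ioi 0)
      (fun s hs => (hd s hs).continuousAt.continuousWithinAt)
      (fun s hs => (hd s (interior_subset hs)).hasDerivWithinAt) (fun s hs => ?_)
    have : (0 : ℝ) < s := interior_subset hs
    positivity
  have hEt : En t = 0 := by simp [hEn, h0, hD]
  obtain ⟨s, hs, hs0⟩ := ((eventually_besselJ_pos (ν := ν) (by linarith)).and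
    (Ioo_mem_nhdsGT ht)).exists
  have hE0 : En =ᶠ[𝓝 s] fun _ => 0 := by
    filter_upwards [Ioo_mem_nhds hs0.1 hs0.2] with x hx
    exact le_antisymm ((hmono hx.1 ht hx.2.le).trans hEt.le) (hnn x hx.1)
  have := (hd s hs0.1).unique ((hasDerivAt_const s (0 : ℝ)).congr_of_eventuallyEq hE0)
  have h1 := hs0.1
  have : 0 < 2 * s * besselJ ν s ^ 2 := by positivity
  linarith

/-- Sturm comparison of Bessel's equation, in the variable `log t`, with `y'' + q² y = 0`: if
`a² ≥ ν² + q²`, then `J_ν` has a zero in `[a, a e^{π/q}]`. -/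
lemma exists_besselJ_eq_zero {ν a q : ℝ} (hν : 1 ≤ ν) (ha : 0 < a) (hq : 0 < q)
    (h : ν ^ 2 + q ^ 2 ≤ a ^ 2) :
    ∃ t ∈ Icc a (a * Real.exp (Real.pi / q)), besselJ ν t = 0 := by
  by_contra! hne
  set b := a * Real.exp (Real.pi / q) with hb
  have hab : a ≤ b := le_mul_of_one_le_right ha.le (Real.one_le_exp (by positivity))
  have hb0 : 0 < b := ha.trans_le hab
  have hsgn : ∀ t ∈ Icc a b, 0 < besselJ ν a * besselJ ν t := fun t ht =>
    mul_pos_of_forall_ne_zero isPreconnected_Icc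
      ((continuousOn_besselJ hν).mono fun x hx => ha.trans_le hx.1) hne
      (left_mem_Icc.2 hab) ht
  -- the Wronskian of `J_ν` and the comparison solution `sin (q log (t / a))`
  set W : ℝ → ℝ := fun t => besselJ ν a * (besselD ν t * Real.sin (q * (Real.log t - Real.log a))
    - q * (besselJ ν t * Real.cos (q * (Real.log t - Real.log a)))) with hW
  have hd : ∀ t, 0 < t → HasDerivAt W ((ν ^ 2 + q ^ 2 - t ^ 2) * (besselJ ν a * besselJ ν t) *
      Real.sin (q * (Real.log t - Real.log a)) / t) t := by
    intro t ht
    have hθ : HasDerivAt (fun t => q * (Real.log t - Real.log a)) (q * t⁻¹) t :=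
      ((Real.hasDerivAt_log ht.ne').sub_const _).const_mul q
    refine ((((hasDerivAt_besselD hν ht).mul hθ.sin).sub
      (((hasDerivAt_besselJ_div hν ht).mul hθ.cos).const_mul q)).const_mul _).congr_deriv ?_
    field_simp
    ring
  have hanti : AntitoneOn W (Icc a b) := by
    refine antitoneOn_of_hasDerivWithinAt_nonpos (convex_Icc a b)
      (fun t ht => (hd t (ha.trans_le ht.1)).continuousAt.continuousWithinAt)
      (fun t ht => (hd t (ha.trans_le (interior_subset ht).1)).hasDerivWithinAt) (fun t ht => ?_)
    have ht' := interior_subset ht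
    have ht0 := ha.trans_le ht'.1
    have h1 : 0 ≤ Real.log t - Real.log a := sub_nonneg.2 (Real.log_le_log ha ht'.1)
    have h2 : Real.log t - Real.log a ≤ Real.pi / q := by
      have := Real.log_le_log ht0 ht'.2
      rw [hb, Real.log_mul ha.ne' (Real.exp_ne_zero _), Real.log_exp] at this
      linarith
    have h3 : 0 ≤ Real.sin (q * (Real.log t - Real.log a)) :=
      Real.sin_nonneg_of_nonneg_of_le_pi (by positivity)
        (by rw [mul_comm]; exact (le_div_iff₀ hq).1 h2)
    have h4 : ν ^ 2 + q ^ 2 - t ^ 2 ≤ 0 := by nlinarith [ht'.1]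
    have h5 := (hsgn t ht').le
    exact div_nonpos_of_nonpos_of_nonneg
      (mul_nonpos_of_nonpos_of_nonneg (mul_nonpos_of_nonpos_of_nonneg h4 h5) h3) ht0.le
  have h1 := hanti (left_mem_Icc.2 hab) (right_mem_Icc.2 hab) hab
  have h2 : q * (Real.log b - Real.log a) = Real.pi := by
    rw [hb, Real.log_mul ha.ne' (Real.exp_ne_zero _), Real.log_exp]
    field_simp
    ring
  simp only [hW, h2, sub_self, mul_zero, Real.sin_zero, Real.cos_zero, Real.sin_pi, Real.cos_pi]
    at h1
  have h3 := mul_pos hq (hsgn a (left_mem_Icc.2 hab))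
  have h4 := mul_pos hq (hsgn b (right_mem_Icc.2 hab))
  nlinarith

/-! ### The zeros of `J_ν` -/

lemma sInf_besselJ_zeros_mem {ν a : ℝ} (hν : 1 ≤ ν) (ha : 0 ≤ a)
    (h : ∀ᶠ t in 𝓝[>] a, besselJ ν t ≠ 0) :
    sInf {t : ℝ | a < t ∧ besselJ ν t = 0} ∈ {t : ℝ | a < t ∧ besselJ ν t = 0} := by
  obtain ⟨b, hab, hb⟩ := mem_nhdsGT_iff_exists_Ioo_subset.1 h
  have hb0 : 0 < b := ha.trans_lt hab
  have hS : {t : ℝ | a < t ∧ besselJ ν t = 0} = Ici b ∩ besselJ ν ⁻¹' {0} := by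
    ext t
    refine ⟨fun ht => ⟨?_, ht.2⟩, fun ht => ⟨lt_of_lt_of_le hab ht.1, ht.2⟩⟩
    by_contra hbt
    exact hb ⟨ht.1, not_le.1 hbt⟩ ht.2
  have hcl : IsClosed (Ici b ∩ besselJ ν ⁻¹' {0}) :=
    ((continuousOn_besselJ hν).mono fun x hx => hb0.trans_le hx).preimage_isClosed_of_isClosed
      isClosed_Ici isClosed_singleton
  obtain ⟨t, ht, ht0⟩ := exists_besselJ_eq_zero (a := ν + 1 + b) (q := 1) hν (by linarith) one_pos
    (by nlinarith)
  rw [hS]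
  refine hcl.csInf_mem ⟨t, ?_, ht0⟩ ⟨b, fun x hx => hx.1⟩
  have := ht.1
  exact mem_Ici.2 (by linarith)

lemma eventually_besselJ_ne_zero {ν : ℝ} (hν : 1 ≤ ν) (s : ℕ) :
    0 ≤ besselZero ν s ∧ ∀ᶠ t in 𝓝[>] (besselZero ν s), besselJ ν t ≠ 0 := by
  induction s with
  | zero =>
    refine ⟨le_rfl, ?_⟩
    filter_upwards [eventually_besselJ_pos (ν := ν) (by linarith)] with t ht using ht.ne'
  | succ s ih =>
    have h := sInf_besselJ_zeros_mem hν ih.1 ih.2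
    have hpos : 0 < besselZero ν (s + 1) := ih.1.trans_lt h.1
    refine ⟨hpos.le, ?_⟩
    have hd := hasDerivAt_besselJ_div hν hpos
    have hne := besselD_ne_zero hν hpos h.2
    exact nhdsWithin_mono _ (fun x hx => ne_of_gt hx)
      (hd.eventually_ne (c := 0) (div_ne_zero hne hpos.ne'))

lemma besselZero_lt_succ {ν : ℝ} (hν : 1 ≤ ν) (s : ℕ) : besselZero ν s < besselZero ν (s + 1) :=
  (sInf_besselJ_zeros_mem hν (eventually_besselJ_ne_zero hν s).1
    (eventually_besselJ_ne_zero hν s).2).1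

lemma besselJ_besselZero {ν : ℝ} (hν : 1 ≤ ν) (s : ℕ) : besselJ ν (besselZero ν (s + 1)) = 0 :=
  (sInf_besselJ_zeros_mem hν (eventually_besselJ_ne_zero hν s).1
    (eventually_besselJ_ne_zero hν s).2).2

lemma besselJ_ne_zero_of_mem_Ioo {ν t : ℝ} {s : ℕ}
    (ht : t ∈ Ioo (besselZero ν s) (besselZero ν (s + 1))) : besselJ ν t ≠ 0 := fun h =>
  (notMem_of_lt_csInf ht.2 ⟨besselZero ν s, fun _ hx => hx.1.le⟩) ⟨ht.1, h⟩

lemma lt_besselZero {ν : ℝ} (hν : 1 ≤ ν) (s : ℕ) : ν < besselZero ν (s + 1) := by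
  by_contra! h
  exact (besselJ_pos hν ((eventually_besselJ_ne_zero hν s).1.trans_lt
    (besselZero_lt_succ hν s)) h).ne' (besselJ_besselZero hν s)

lemma besselZero_le {ν a q : ℝ} (hν : 1 ≤ ν) (ha : 0 < a) (hq : 0 < q)
    (h : ν ^ 2 + q ^ 2 ≤ a ^ 2) (s : ℕ) :
    besselZero ν s ≤ a * Real.exp (2 * Real.pi * s / q) := by
  induction s with
  | zero => simpa [besselZero] using ha.le
  | succ s ih =>
    set A := a * Real.exp (2 * Real.pi * s / q) with hA
    have hA0 : 0 < A := by positivity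
    have haA : a ≤ A := le_mul_of_one_le_right ha.le (Real.one_le_exp (by positivity))
    have h1 : A < A * Real.exp (Real.pi / q) :=
      lt_mul_of_one_lt_right hA0 (Real.one_lt_exp_iff.2 (by positivity))
    obtain ⟨t, ht, ht0⟩ := exists_besselJ_eq_zero (a := A * Real.exp (Real.pi / q)) hν
      (by positivity) hq (h.trans (by gcongr; linarith))
    have h2 : besselZero ν (s + 1) ≤ t :=
      csInf_le ⟨besselZero ν s, fun _ hx => hx.1.le⟩ ⟨ih.trans_lt (h1.trans_le ht.1), ht0⟩
    refine h2.trans (ht.2.trans_eq ?_)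
    rw [hA, mul_assoc, mul_assoc, ← Real.exp_add, ← Real.exp_add]
    congr 2
    push_cast
    field_simp
    ring

/-- For fixed `s`, the zeros satisfy `j_{ν,s} < Q ν` for every `Q > 1` and all large `ν`. -/
lemma eventually_besselZero_lt (s : ℕ) {Q : ℝ} (hQ : 1 < Q) :
    ∀ᶠ ν : ℝ in atTop, besselZero ν s < Q * ν := by
  set p := (1 + Q) / 2 with hp
  have hp1 : 1 < p := by rw [hp]; linarith
  have hpQ : p < Q := by rw [hp]; linarith
  set c := Real.sqrt (p ^ 2 - 1) with hc
  have hc1 : 0 < p ^ 2 - 1 := by nlinarith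
  have hc0 : 0 < c := Real.sqrt_pos.2 hc1
  have hlim : Tendsto (fun ν : ℝ => p * Real.exp (2 * Real.pi * s / (c * ν))) atTop
      (𝓝 (p * Real.exp 0)) := by
    refine Tendsto.const_mul p ((Real.continuous_exp.tendsto 0).comp ?_)
    exact Tendsto.const_div_atTop (tendsto_id.const_mul_atTop hc0) _
  rw [Real.exp_zero, mul_one] at hlim
  filter_upwards [hlim.eventually (gt_mem_nhds hpQ), eventually_ge_atTop 1] with ν h1 hν
  have h2 := besselZero_le (a := p * ν) (q := c * ν) hν (by positivity) (by positivity) (by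
    rw [mul_pow, mul_pow, hc, Real.sq_sqrt hc1.le]; exact le_of_eq (by ring)) s
  calc besselZero ν s ≤ p * Real.exp (2 * Real.pi * s / (c * ν)) * ν := by linarith
    _ < Q * ν := by gcongr

lemma deriv_mul_nonneg_of_pos_right {f : ℝ → ℝ} {f' a b σ : ℝ} (hf : HasDerivAt f f' a)
    (ha : f a = 0) (hab : a < b) (hpos : ∀ t ∈ Ioo a b, 0 < σ * f t) : 0 ≤ σ * f' := by
  have h := (hasDerivWithinAt_iff_tendsto_slope' (by simp)).1
    ((hf.const_mul σ).hasDerivWithinAt (s := Ioi a))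
  refine ge_of_tendsto h ?_
  filter_upwards [Ioo_mem_nhdsGT hab] with t ht
  rw [slope_def_field, ha, mul_zero, sub_zero]
  exact div_nonneg (hpos t ht).le (sub_nonneg.2 ht.1.le)

lemma deriv_mul_nonpos_of_pos_left {f : ℝ → ℝ} {f' a b σ : ℝ} (hf : HasDerivAt f f' b)
    (hb : f b = 0) (hab : a < b) (hpos : ∀ t ∈ Ioo a b, 0 < σ * f t) : σ * f' ≤ 0 := by
  have h := (hasDerivWithinAt_iff_tendsto_slope' (by simp)).1
    ((hf.const_mul σ).hasDerivWithinAt (s := Iio b))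
  refine le_of_tendsto h ?_
  filter_upwards [Ioo_mem_nhdsLT hab] with t ht
  rw [slope_def_field, hb, mul_zero, sub_zero]
  exact div_nonpos_of_nonneg_of_nonpos (hpos t ht).le (sub_nonpos.2 ht.2.le)

/-- At consecutive zeros, `J_ν' = J_{ν-1}` has opposite signs. -/
lemma besselJ_sub_one_mul_neg {ν : ℝ} (hν : 1 ≤ ν) (s : ℕ) :
    besselJ (ν - 1) (besselZero ν (s + 1)) * besselJ (ν - 1) (besselZero ν (s + 2)) < 0 := by
  set a := besselZero ν (s + 1)
  set b := besselZero ν (s + 2)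
  have hab : a < b := besselZero_lt_succ hν (s + 1)
  have ha : 0 < a := by linarith [lt_besselZero hν s]
  have hJa : besselJ ν a = 0 := besselJ_besselZero hν s
  have hJb : besselJ ν b = 0 := besselJ_besselZero hν (s + 1)
  have key : ∀ x, 0 < x → besselJ ν x = 0 →
      HasDerivAt (besselJ ν) (besselJ (ν - 1) x) x ∧ besselJ (ν - 1) x ≠ 0 := by
    intro x hx h0
    have h1 : besselD ν x = x * besselJ (ν - 1) x := by rw [besselD, h0]; ring
    have h2 := besselD_ne_zero hν hx h0
    rw [h1] at h2
    refine ⟨(hasDerivAt_besselJ_div hν hx).congr_deriv ?_, right_ne_zero_of_mul h2⟩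
    rw [h1, mul_div_cancel_left₀ _ hx.ne']
  obtain ⟨hda, hna⟩ := key a ha hJa
  obtain ⟨hdb, hnb⟩ := key b (ha.trans hab) hJb
  set σ := besselJ ν ((a + b) / 2)
  have hσ : σ ≠ 0 := besselJ_ne_zero_of_mem_Ioo (s := s + 1) ⟨by linarith, by linarith⟩
  have hpos : ∀ t ∈ Ioo a b, 0 < σ * besselJ ν t := fun t ht =>
    mul_pos_of_forall_ne_zero isPreconnected_Ioo
      ((continuousOn_besselJ hν).mono fun x hx => ha.trans hx.1)
      (fun x hx => besselJ_ne_zero_of_mem_Ioo (s := s + 1) hx) ⟨by linarith, by linarith⟩ ht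
  have h1 := deriv_mul_nonneg_of_pos_right hda hJa hab hpos
  have h2 := deriv_mul_nonpos_of_pos_left hdb hJb hab hpos
  refine lt_of_le_of_ne ?_ (mul_ne_zero hna hnb)
  have h3 := mul_nonpos_of_nonneg_of_nonpos h1 h2
  have h4 : 0 < σ ^ 2 := by positivity
  by_contra! h5
  nlinarith [mul_pos h4 h5]

/-! ### Zeros of the characteristic function -/

lemma continuousOn_charFun {n ν : ℝ} (hn : 0 < n) (hν : 1 ≤ ν) :
    ContinuousOn (charFun n ν) (Ioi 0) := by
  have h1 : ContinuousOn (besselJ (ν - 1)) (Ioi 0) := fun t ht =>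
    (hasDerivAt_besselJ (by linarith) ht).continuousAt.continuousWithinAt
  have h2 := continuousOn_besselJ hν
  have h3 : ContinuousOn (fun k : ℝ => k * n) (Ioi 0) := by fun_prop
  have h4 : MapsTo (fun k : ℝ => k * n) (Ioi 0) (Ioi 0) := fun k hk => mul_pos hk hn
  exact (h1.mul (h2.comp h3 h4)).sub ((continuousOn_const.mul h2).mul (h1.comp h3 h4))

/-- The characteristic function changes sign between consecutive zeros of
`J_ν(max(n, 1) k)`, provided that these lie before the turning point of the other factor
`J_ν(min(n, 1) k)`. -/
lemma exists_isModeZero {n ν : ℝ} (hn : 0 < n) (hn1 : n ≠ 1) (hν : 1 ≤ ν) (s : ℕ)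
    (hs : besselZero ν (s + 2) * (min n 1 / max n 1) ≤ ν) :
    ∃ k, IsModeZero n ν (s + 1) k := by
  have hM : 0 < max n 1 := by positivity
  have hm : 0 < min n 1 := by positivity
  set a := besselZero ν (s + 1) with ha
  set b := besselZero ν (s + 2) with hb
  have hab : a < b := besselZero_lt_succ hν (s + 1)
  have ha0 : 0 < a := by linarith [lt_besselZero hν s]
  have hb0 : 0 < b := ha0.trans hab
  have hJa : besselJ ν a = 0 := besselJ_besselZero hν s
  have hJb : besselJ ν b = 0 := besselJ_besselZero hν (s + 1)
  have hneg : besselJ (ν - 1) a * besselJ (ν - 1) b < 0 := besselJ_sub_one_mul_neg hν s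
  have hpos : 0 < besselJ ν (a * (min n 1 / max n 1)) * besselJ ν (b * (min n 1 / max n 1)) := by
    refine mul_pos (besselJ_pos hν (by positivity) (le_trans ?_ hs))
      (besselJ_pos hν (by positivity) hs)
    gcongr
  have hends : charFun n ν (a / max n 1) * charFun n ν (b / max n 1) < 0 := by
    rcases lt_or_gt_of_ne hn1 with h | h
    · rw [max_eq_right h.le, min_eq_left h.le, div_one] at hpos
      rw [max_eq_right h.le, div_one, div_one, charFun, charFun, hJa, hJb]
      nlinarith [mul_neg_of_neg_of_pos hneg hpos]
    · rw [max_eq_left h.le, min_eq_right h.le, mul_one_div, mul_one_div] at hpos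
      rw [max_eq_left h.le, charFun, charFun, div_mul_cancel₀ _ hn.ne', div_mul_cancel₀ _ hn.ne',
        hJa, hJb]
      have h1 : 0 < n ^ 2 := by positivity
      nlinarith [mul_neg_of_neg_of_pos hneg (mul_pos h1 hpos)]
  have hab' : a / max n 1 < b / max n 1 := by gcongr
  have hex : ∃ k ∈ Icc (a / max n 1) (b / max n 1), charFun n ν k = 0 := by
    by_contra! hne
    refine absurd (mul_pos_of_forall_ne_zero isPreconnected_Icc
      ((continuousOn_charFun hn hν).mono fun x hx => ?_) hne
      (left_mem_Icc.2 hab'.le) (right_mem_Icc.2 hab'.le)) (not_lt.2 hends.le)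
    exact lt_of_lt_of_le (by positivity) hx.1
  obtain ⟨k, hk, hk0⟩ := hex
  refine ⟨k, ⟨lt_of_le_of_ne hk.1 ?_, lt_of_le_of_ne hk.2 ?_⟩, hk0⟩
  · rintro rfl
    rw [hk0, zero_mul] at hends
    exact lt_irrefl _ hends
  · rintro rfl
    rw [hk0, mul_zero] at hends
    exact lt_irrefl _ hends

lemma IsModeZero.lt_mul_max {n ν k : ℝ} {s : ℕ} (h : IsModeZero n ν s k) :
    besselZero ν s < k * max n 1 :=
  (div_lt_iff₀ (by positivity)).1 h.1.1

lemma IsModeZero.mul_max_lt {n ν k : ℝ} {s : ℕ} (h : IsModeZero n ν s k) :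
    k * max n 1 < besselZero ν (s + 1) :=
  (lt_div_iff₀ (by positivity)).1 h.1.2

lemma IsModeZero.pos {n ν k : ℝ} {s : ℕ} (hν : 1 ≤ ν) (h : IsModeZero n ν s k) : 0 < k :=
  lt_of_le_of_lt (div_nonneg (eventually_besselJ_ne_zero hν s).1 (by positivity)) h.1.1

lemma IsModeZero.besselJ_ne_zero {n ν k : ℝ} {s : ℕ} (hn : 0 < n) (hν : 1 ≤ ν)
    (hs : besselZero ν (s + 1) * (min n 1 / max n 1) ≤ ν) (h : IsModeZero n ν s k) :
    besselJ ν k ≠ 0 ∧ besselJ ν (k * n) ≠ 0 := by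
  have hk := h.pos hν
  have h1 : besselJ ν (k * max n 1) ≠ 0 :=
    besselJ_ne_zero_of_mem_Ioo ⟨h.lt_mul_max, h.mul_max_lt⟩
  have hM : 0 < max n 1 := by positivity
  have hm : 0 < min n 1 := by positivity
  have h2 : besselJ ν (k * min n 1) ≠ 0 := by
    refine (besselJ_pos hν (by positivity) (le_trans ?_ hs)).ne'
    rw [mul_div_assoc', le_div_iff₀ hM, mul_right_comm]
    gcongr
    exact h.mul_max_lt.le
  rcases le_total n 1 with hle | hle
  · rw [max_eq_right hle, mul_one] at h1
    rw [min_eq_left hle] at h2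
    exact ⟨h1, h2⟩
  · rw [max_eq_left hle] at h1
    rw [min_eq_right hle, mul_one] at h2
    exact ⟨h2, h1⟩

/-- The condition `f_ν(k) = 0` in terms of `F_ν`: it matches the normal derivatives. -/
lemma besselEntire_matching {n ν k : ℝ} (hn : 0 < n) (hν : 1 ≤ ν) (hk : 0 < k)
    (h : charFun n ν k = 0) :
    n ^ 2 * (besselEntire (ν + 1) ((k * n) ^ 2 / 4) * besselEntire ν (k ^ 2 / 4)) =
      besselEntire ν ((k * n) ^ 2 / 4) * besselEntire (ν + 1) (k ^ 2 / 4) := by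
  have hkn : 0 < k * n := by positivity
  rw [charFun, besselJ_eq hk, besselJ_eq hk, besselJ_eq hkn, besselJ_eq hkn,
    besselEntire_sub_one hν, besselEntire_sub_one hν, Real.rpow_sub_one (by positivity),
    Real.rpow_sub_one (by positivity)] at h
  have h1 : 0 < (k / 2) ^ ν := by positivity
  have h2 : 0 < (k * n / 2) ^ ν := by positivity
  have h3 : 2 * (k / 2) ^ ν * (k * n / 2) ^ ν * k ^ 2 ≠ 0 := by positivity
  refine mul_left_cancel₀ h3 ?_
  field_simp at h
  rw [mul_pow]
  linear_combination h

lemma eventually_besselZero_mul_le {n : ℝ} (hn : 0 < n) (hn1 : n ≠ 1) (s : ℕ) :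
    ∀ᶠ ν : ℝ in atTop, besselZero ν s * (min n 1 / max n 1) ≤ ν := by
  have hm : 0 < min n 1 := by positivity
  have hM : 0 < max n 1 := by positivity
  have hQ : 1 < max n 1 / min n 1 := (one_lt_div hm).2 (min_lt_max.2 hn1)
  filter_upwards [eventually_besselZero_lt s hQ] with ν h
  rw [← inv_div, ← div_eq_mul_inv, div_le_iff₀ (by positivity), mul_comm]
  exact h.le

/-! ### Smooth functions and weak derivatives on the unit ball -/

variable {N : ℕ}

instance isFiniteMeasure_restrict_Om : IsFiniteMeasure (volume.restrict (Om N 1)) :=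
  ⟨by rw [Measure.restrict_apply_univ]; exact measure_ball_lt_top⟩

lemma mem_Om_one {x : E N} : x ∈ Om N 1 ↔ ‖x‖ < 1 := mem_ball_zero_iff

lemma contDiff_partialDeriv {g : E N → ℂ} (hg : ContDiff ℝ ∞ g) (i : Fin N) :
    ContDiff ℝ ∞ (partialDeriv i g) :=
  (hg.fderiv_right (m := ∞) (by simp)).clm_apply contDiff_const

lemma partialDeriv_sub {f g : E N → ℂ} (hf : ContDiff ℝ ∞ f) (hg : ContDiff ℝ ∞ g) (i : Fin N) :
    partialDeriv i (fun x => f x - g x) = fun x => partialDeriv i f x - partialDeriv i g x := by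
  ext x
  have := fderiv_fun_sub (𝕜 := ℝ) (hf.differentiable (by simp) x) (hg.differentiable (by simp) x)
  simp [partialDeriv, this]

lemma partialDeriv_mul {f g : E N → ℂ} (hf : ContDiff ℝ ∞ f) (hg : ContDiff ℝ ∞ g) (i : Fin N) :
    partialDeriv i (fun x => f x * g x) =
      fun x => partialDeriv i f x * g x + f x * partialDeriv i g x := by
  ext x
  have := fderiv_fun_mul (𝕜 := ℝ) (hf.differentiable (by simp) x) (hg.differentiable (by simp) x)
  simp only [partialDeriv, this, add_apply, smul_apply,
    smul_eq_mul]
  ring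

lemma exists_norm_le_on_Om {g : E N → ℂ} (hg : Continuous g) :
    ∃ C, 0 ≤ C ∧ ∀ x ∈ Om N 1, ‖g x‖ ≤ C := by
  obtain ⟨C, hC⟩ := (isCompact_closedBall (0 : E N) 1).exists_bound_of_continuousOn hg.continuousOn
  exact ⟨max C 0, le_max_right _ _,
    fun x hx => (hC x (Metric.ball_subset_closedBall hx)).trans (le_max_left _ _)⟩

lemma memLp_two_of_continuous {g : E N → ℂ} (hg : Continuous g) :
    MemLp g 2 (volume.restrict (Om N 1)) := by
  obtain ⟨C, -, hC⟩ := exists_norm_le_on_Om hg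
  refine MemLp.of_bound hg.aestronglyMeasurable C ?_
  exact (ae_restrict_iff' measurableSet_ball).2 (ae_of_all _ hC)

lemma IsTestFunction.partialDeriv_eq_zero {U : Set (E N)} {φ : E N → ℂ} (hφ : IsTestFunction U φ)
    (i : Fin N) {x : E N} (hx : x ∉ U) : partialDeriv i φ x = 0 := by
  have h := image_eq_zero_of_notMem_tsupport (f := fderiv ℝ φ)
    fun h => hx (hφ.subset (tsupport_fderiv_subset ℝ h))
  rw [partialDeriv, h, zero_apply]

/-- Integration by parts of a smooth function against a test function. -/
lemma setIntegral_mul_partialDeriv {U : Set (E N)} {g φ : E N → ℂ} (hg : ContDiff ℝ ∞ g)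
    (hφ : IsTestFunction U φ) (i : Fin N) :
    ∫ x in U, g x * partialDeriv i φ x = -∫ x in U, partialDeriv i g x * φ x := by
  have hdφ : HasCompactSupport (partialDeriv i φ) := by
    refine (hφ.compact.fderiv (𝕜 := ℝ)).comp_left
      (g := fun L : E N →L[ℝ] ℂ => L (EuclideanSpace.single i 1)) ?_
    simp
  rw [setIntegral_eq_integral_of_forall_compl_eq_zero fun x hx => by
      rw [hφ.partialDeriv_eq_zero i hx, mul_zero],
    setIntegral_eq_integral_of_forall_compl_eq_zero fun x hx => by
      rw [image_eq_zero_of_notMem_tsupport fun h => hx (hφ.subset h), mul_zero]]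
  refine integral_mul_fderiv_eq_neg_fderiv_mul_of_integrable ?_ ?_ ?_
    (fun x _ => hg.differentiable (by simp) x) (fun x _ => hφ.smooth.differentiable (by simp) x)
  · exact ((contDiff_partialDeriv hg i).continuous.mul
      hφ.smooth.continuous).integrable_of_hasCompactSupport hφ.compact.mul_left
  · exact (hg.continuous.mul
      (contDiff_partialDeriv hφ.smooth i).continuous).integrable_of_hasCompactSupport hdφ.mul_left
  · exact (hg.continuous.mul hφ.smooth.continuous).integrable_of_hasCompactSupport
      hφ.compact.mul_left

lemma isH1_of_contDiff {g : E N → ℂ} (hg : ContDiff ℝ ∞ g) :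
    IsH1 (Om N 1) g fun i => partialDeriv i g where
  memL2 := memLp_two_of_continuous hg.continuous
  grad_memL2 i := memLp_two_of_continuous (contDiff_partialDeriv hg i).continuous
  weak i _ hφ := setIntegral_mul_partialDeriv hg hφ i

lemma integrable_mul_of_continuous_of_memLp {g φ : E N → ℂ} (hg : Continuous g)
    (hφ : MemLp φ 2 (volume.restrict (Om N 1))) :
    Integrable (fun x => g x * φ x) (volume.restrict (Om N 1)) := by
  obtain ⟨C, -, hC⟩ := exists_norm_le_on_Om hg
  exact (hφ.integrable (by norm_num)).bdd_mul hg.aestronglyMeasurable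
    ((ae_restrict_iff' measurableSet_ball).2 (ae_of_all _ hC))

lemma weakHelmholtz_of_contDiff {g : E N → ℂ} {κ : ℝ} (hg : ContDiff ℝ ∞ g)
    (h : ∀ x, ∑ i, partialDeriv i (partialDeriv i g) x = -((κ : ℂ) ^ 2 * g x)) :
    WeakHelmholtz (Om N 1) κ g fun i => partialDeriv i g := by
  intro φ hφ
  have hφ2 := memLp_two_of_continuous (N := N) hφ.smooth.continuous
  have hint : ∀ i, Integrable (fun x => partialDeriv i g x * partialDeriv i φ x)
      (volume.restrict (Om N 1)) := fun i =>
    integrable_mul_of_continuous_of_memLp (contDiff_partialDeriv hg i).continuous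
      (memLp_two_of_continuous (contDiff_partialDeriv hφ.smooth i).continuous)
  have hint2 : ∀ i, Integrable (fun x => partialDeriv i (partialDeriv i g) x * φ x)
      (volume.restrict (Om N 1)) := fun i =>
    integrable_mul_of_continuous_of_memLp
      (contDiff_partialDeriv (contDiff_partialDeriv hg i) i).continuous hφ2
  have hint3 : Integrable (fun x => (κ : ℂ) ^ 2 * (g x * φ x)) (volume.restrict (Om N 1)) :=
    (integrable_mul_of_continuous_of_memLp hg.continuous hφ2).const_mul _
  rw [integral_sub (integrable_finsetSum _ fun i _ => hint i) hint3,
    integral_finsetSum _ fun i _ => hint i]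
  simp_rw [fun i => setIntegral_mul_partialDeriv (contDiff_partialDeriv hg i) hφ i]
  rw [Finset.sum_neg_distrib, ← integral_finsetSum _ fun i _ => hint2 i]
  simp_rw [← Finset.sum_mul, h, neg_mul, mul_assoc]
  rw [integral_neg]
  ring

/-! ### Cutoffs and boundary values -/

/-- A smooth cutoff that vanishes for `j (1 - |x|²) ≤ 1` and equals `1` for `j (1 - |x|²) ≥ 2`. -/
noncomputable def cutoff (j : ℕ) (x : E N) : ℝ :=
  Real.smoothTransition (j * (1 - ‖x‖ ^ 2) - 1)

lemma contDiff_cutoff (j : ℕ) : ContDiff ℝ ∞ (cutoff (N := N) j) :=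
  Real.smoothTransition.contDiff.comp
    ((contDiff_const.mul (contDiff_const.sub (contDiff_norm_sq ℝ))).sub contDiff_const)

lemma contDiff_ofReal_cutoff (j : ℕ) : ContDiff ℝ ∞ fun x : E N => (cutoff j x : ℂ) :=
  Complex.ofRealCLM.contDiff.comp (contDiff_cutoff j)

lemma contDiff_mul_cutoff {g : E N → ℂ} (hg : ContDiff ℝ ∞ g) (j : ℕ) :
    ContDiff ℝ ∞ fun x => g x * (cutoff j x : ℂ) :=
  hg.mul (contDiff_ofReal_cutoff j)

lemma isTestFunction_mul_cutoff {g : E N → ℂ} (hg : ContDiff ℝ ∞ g) (j : ℕ) :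
    IsTestFunction (Om N 1) fun x => g x * (cutoff j x : ℂ) := by
  have hcl : IsClosed {x : E N | 1 ≤ j * (1 - ‖x‖ ^ 2)} :=
    isClosed_le continuous_const (by fun_prop)
  have hsub : tsupport (fun x => g x * (cutoff j x : ℂ)) ⊆ {x : E N | 1 ≤ j * (1 - ‖x‖ ^ 2)} := by
    refine closure_minimal (fun x hx => ?_) hcl
    by_contra h
    refine hx ?_
    have h' : (j : ℝ) * (1 - ‖x‖ ^ 2) - 1 ≤ 0 := sub_nonpos.2 (not_le.1 h).le
    simp [cutoff, Real.smoothTransition.zero_of_nonpos h']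
  have hU : {x : E N | 1 ≤ j * (1 - ‖x‖ ^ 2)} ⊆ Om N 1 := by
    intro x hx
    have hx' : 1 ≤ (j : ℝ) * (1 - ‖x‖ ^ 2) := hx
    rw [mem_Om_one]
    by_contra! h
    have hj : (0 : ℝ) ≤ j := Nat.cast_nonneg j
    nlinarith [mul_nonneg hj (show (0 : ℝ) ≤ ‖x‖ ^ 2 - 1 by nlinarith)]
  refine ⟨contDiff_mul_cutoff hg j, ?_, hsub.trans hU⟩
  exact (isCompact_closedBall (0 : E N) 1).of_isClosed_subset (isClosed_tsupport _)
    ((hsub.trans hU).trans Metric.ball_subset_closedBall)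

lemma deriv_smoothTransition_of_one_lt {t : ℝ} (ht : 1 < t) :
    deriv Real.smoothTransition t = 0 := by
  have h : Real.smoothTransition =ᶠ[𝓝 t] fun _ => 1 := by
    filter_upwards [lt_mem_nhds ht] with s hs using Real.smoothTransition.one_of_one_le hs.le
  rw [h.deriv_eq, deriv_const]

lemma deriv_smoothTransition_of_neg {t : ℝ} (ht : t < 0) : deriv Real.smoothTransition t = 0 := by
  have h : Real.smoothTransition =ᶠ[𝓝 t] fun _ => 0 := by
    filter_upwards [gt_mem_nhds ht] with s hs using Real.smoothTransition.zero_of_nonpos hs.le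
  rw [h.deriv_eq, deriv_const]

lemma exists_abs_deriv_smoothTransition_le :
    ∃ M, 0 ≤ M ∧ ∀ t, |deriv Real.smoothTransition t| ≤ M := by
  have hc : Continuous (deriv Real.smoothTransition) :=
    (Real.smoothTransition.contDiff (n := 1)).continuous_deriv (by simp)
  obtain ⟨M, hM⟩ := (isCompact_Icc (a := (0 : ℝ)) (b := 1)).exists_bound_of_continuousOn
    hc.continuousOn
  refine ⟨max M 0, le_max_right _ _, fun t => ?_⟩
  by_cases h0 : t < 0
  · simp [deriv_smoothTransition_of_neg h0]
  by_cases h1 : 1 < t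
  · simp [deriv_smoothTransition_of_one_lt h1]
  exact (hM t ⟨not_lt.1 h0, not_lt.1 h1⟩).trans (le_max_left _ _)

lemma partialDeriv_norm_sq_comp {f : ℝ → ℝ} (hf : Differentiable ℝ f) (i : Fin N) (x : E N) :
    partialDeriv i (fun x => (f (‖x‖ ^ 2) : ℂ)) x = (deriv f (‖x‖ ^ 2) * (2 * x i) : ℝ) := by
  have h1 : HasFDerivAt (fun x : E N => ‖x‖ ^ 2) (2 • innerSL ℝ x) x :=
    (hasStrictFDerivAt_norm_sq x).hasFDerivAt
  have h2 := Complex.ofRealCLM.hasFDerivAt.comp x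
    ((hf (‖x‖ ^ 2)).hasDerivAt.comp_hasFDerivAt x h1)
  rw [partialDeriv]
  erw [h2.fderiv]
  simp [EuclideanSpace.inner_single_right]

lemma partialDeriv_mul_cutoff {g : E N → ℂ} (hg : ContDiff ℝ ∞ g) (j : ℕ) (i : Fin N) (x : E N) :
    partialDeriv i (fun x => g x * (cutoff j x : ℂ)) x = partialDeriv i g x * (cutoff j x : ℂ) +
      g x * ((deriv Real.smoothTransition (j * (1 - ‖x‖ ^ 2) - 1) * (-(2 * j * x i)) : ℝ) : ℂ) := by
  rw [partialDeriv_mul hg (contDiff_ofReal_cutoff j)]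
  have hd : ∀ s : ℝ, HasDerivAt (fun s : ℝ => Real.smoothTransition (j * (1 - s) - 1))
      (deriv Real.smoothTransition (j * (1 - s) - 1) * (-j)) s := by
    intro s
    have h1 : HasDerivAt (fun s : ℝ => (j : ℝ) * (1 - s) - 1) (-j) s := by
      simpa using (((hasDerivAt_id s).const_sub 1).const_mul (j : ℝ)).sub_const 1
    exact ((Real.smoothTransition.contDiff (n := 1)).differentiable
      (by simp) _).hasDerivAt.comp s h1
  have := partialDeriv_norm_sq_comp (N := N) (fun s => (hd s).differentiableAt) i x
  rw [(hd _).deriv] at this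
  refine congrArg (partialDeriv i g x * (cutoff j x : ℂ) + g x * ·) (this.trans ?_)
  push_cast
  ring

/-- A smooth function that vanishes on the unit sphere is `O(1 - |x|²)` in the ball. -/
lemma exists_norm_le_one_sub_norm_sq {g : E N → ℂ} (hg : ContDiff ℝ ∞ g) (i : Fin N)
    (h0 : ∀ x : E N, ‖x‖ = 1 → g x = 0) :
    ∃ C, 0 ≤ C ∧ ∀ x ∈ Om N 1, ‖g x‖ ≤ C * (1 - ‖x‖ ^ 2) := by
  obtain ⟨C, hC⟩ := (isCompact_closedBall (0 : E N) 1).exists_bound_of_continuousOn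
    (hg.continuous_fderiv (by simp)).continuousOn
  have hC0 : 0 ≤ C := (norm_nonneg _).trans (hC 0 (by simp))
  refine ⟨C, hC0, fun x hx => ?_⟩
  rw [mem_Om_one] at hx
  obtain ⟨y, hy, hxy⟩ : ∃ y : E N, ‖y‖ = 1 ∧ ‖x - y‖ ≤ 1 - ‖x‖ := by
    by_cases hx0 : x = 0
    · exact ⟨EuclideanSpace.single i 1, by simp, by simp [hx0]⟩
    · have hn : ‖x‖ ≠ 0 := norm_ne_zero_iff.2 hx0
      refine ⟨‖x‖⁻¹ • x, by rw [norm_smul, norm_inv, norm_norm, inv_mul_cancel₀ hn], ?_⟩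
      have : x - ‖x‖⁻¹ • x = (1 - ‖x‖⁻¹) • x := by rw [sub_smul, one_smul]
      rw [this, norm_smul, Real.norm_eq_abs, abs_of_nonpos]
      · apply le_of_eq; field_simp; ring
      · rw [sub_nonpos]
        exact (one_le_inv₀ (by positivity)).2 hx.le
  have h := (convex_closedBall (0 : E N) 1).norm_image_sub_le_of_norm_fderiv_le (𝕜 := ℝ)
    (fun z _ => hg.differentiable (by simp) z) hC (x := y) (y := x)
    (by simp [hy]) (by simpa using hx.le)
  rw [h0 y hy, sub_zero] at h
  have hxn := norm_nonneg x
  calc ‖g x‖ ≤ C * ‖x - y‖ := h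
    _ ≤ C * (1 - ‖x‖ ^ 2) := by
      refine mul_le_mul_of_nonneg_left (hxy.trans ?_) hC0
      nlinarith

lemma eventually_mul_cutoff_eq {g : E N → ℂ} (hg : ContDiff ℝ ∞ g) {x : E N} (hx : x ∈ Om N 1) :
    ∀ᶠ j : ℕ in atTop, g x * (cutoff j x : ℂ) = g x ∧
      ∀ i, partialDeriv i (fun x => g x * (cutoff j x : ℂ)) x = partialDeriv i g x := by
  rw [mem_Om_one] at hx
  have hx2 : 0 < 1 - ‖x‖ ^ 2 := by nlinarith [norm_nonneg x]
  have h := (tendsto_natCast_atTop_atTop (R := ℝ)).atTop_mul_const hx2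
  filter_upwards [h.eventually_gt_atTop 2] with j hj
  have h1 : cutoff j x = 1 := Real.smoothTransition.one_of_one_le (by linarith)
  refine ⟨by simp [h1], fun i => ?_⟩
  rw [partialDeriv_mul_cutoff hg, deriv_smoothTransition_of_one_lt (by linarith), h1]
  simp

lemma norm_mul_cutoff_le (g : E N → ℂ) (j : ℕ) (x : E N) :
    ‖g x * (cutoff j x : ℂ)‖ ≤ ‖g x‖ := by
  rw [norm_mul, Complex.norm_real, Real.norm_eq_abs, cutoff,
    abs_of_nonneg (Real.smoothTransition.nonneg _)]
  exact mul_le_of_le_one_right (norm_nonneg _) (Real.smoothTransition.le_one _)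

/-- The derivatives of `g χ_j` are bounded uniformly in `j` if `g` vanishes on the sphere: where
`∇χ_j = O(j)` is nonzero, `g = O(1 - |x|²) = O(1 / j)`. -/
lemma exists_norm_partialDeriv_mul_cutoff_le {g : E N → ℂ} (hg : ContDiff ℝ ∞ g) (i : Fin N)
    (h0 : ∀ x : E N, ‖x‖ = 1 → g x = 0) :
    ∃ C, 0 ≤ C ∧ ∀ j : ℕ, ∀ x ∈ Om N 1,
      ‖partialDeriv i (fun x => g x * (cutoff j x : ℂ)) x‖ ≤ C := by
  obtain ⟨C, hC0, hC⟩ := exists_norm_le_one_sub_norm_sq hg i h0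
  obtain ⟨B, hB0, hB⟩ := exists_norm_le_on_Om (contDiff_partialDeriv hg i).continuous
  obtain ⟨M, hM0, hM⟩ := exists_abs_deriv_smoothTransition_le
  refine ⟨B + 4 * C * M, by positivity, fun j x hx => ?_⟩
  rw [partialDeriv_mul_cutoff hg]
  refine (norm_add_le _ _).trans (add_le_add
    ((norm_mul_cutoff_le (partialDeriv i g) j x).trans (hB x hx)) ?_)
  by_cases hj : 1 < (j : ℝ) * (1 - ‖x‖ ^ 2) - 1
  · rw [deriv_smoothTransition_of_one_lt hj]
    simp only [zero_mul, Complex.ofReal_zero, mul_zero, norm_zero]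
    positivity
  · have hxi : |x i| ≤ 1 := by
      have h1 := PiLp.norm_apply_le x i
      rw [Real.norm_eq_abs] at h1
      exact h1.trans (mem_Om_one.1 hx).le
    rw [norm_mul, Complex.norm_real, Real.norm_eq_abs, abs_mul, abs_neg, abs_mul, abs_mul, abs_two,
      Nat.abs_cast]
    have hj0 : (0 : ℝ) ≤ j := Nat.cast_nonneg j
    have hx2 : 0 ≤ 1 - ‖x‖ ^ 2 := by nlinarith [mem_Om_one.1 hx, norm_nonneg x]
    calc ‖g x‖ * (|deriv Real.smoothTransition (j * (1 - ‖x‖ ^ 2) - 1)| * (2 * j * |x i|))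
        ≤ C * (1 - ‖x‖ ^ 2) * (M * (2 * j * 1)) := by
          gcongr
          · exact hC x hx
          · exact hM _
      _ = 2 * C * M * (j * (1 - ‖x‖ ^ 2)) := by ring
      _ ≤ 2 * C * M * 2 := by gcongr; linarith
      _ = 4 * C * M := by ring

lemma tendsto_eLpNorm_two_zero_of_bounded {f : E N → ℂ} {F : ℕ → E N → ℂ} {C : ℝ}
    (hF : ∀ j, Continuous (F j)) (hf : Continuous f)
    (hC : ∀ j, ∀ x ∈ Om N 1, ‖f x - F j x‖ ≤ C)
    (h : ∀ x ∈ Om N 1, ∀ᶠ j in atTop, F j x = f x) :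
    Tendsto (fun j => eLpNorm (fun x => f x - F j x) 2 (volume.restrict (Om N 1))) atTop (𝓝 0) := by
  have key : Tendsto (fun j => ∫⁻ x in Om N 1, ‖f x - F j x‖ₑ ^ (2 : ℝ)) atTop
      (𝓝 (∫⁻ _ in Om N 1, 0)) := by
    refine tendsto_lintegral_of_dominated_convergence' (fun _ => ENNReal.ofReal C ^ (2 : ℝ))
      (fun j => ?_) (fun j => ?_) ?_ ?_
    · exact ((hf.sub (hF j)).enorm.measurable.pow_const _).aemeasurable
    · refine (ae_restrict_iff' measurableSet_ball).2 (ae_of_all _ fun x hx => ?_)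
      refine ENNReal.rpow_le_rpow ?_ (by norm_num)
      rw [← ofReal_norm]
      exact ENNReal.ofReal_le_ofReal (hC j x hx)
    · rw [lintegral_const]
      exact ENNReal.mul_ne_top (by simp) (measure_ne_top _ _)
    · refine (ae_restrict_iff' measurableSet_ball).2 (ae_of_all _ fun x hx => ?_)
      refine tendsto_const_nhds.congr' ?_
      filter_upwards [h x hx] with j hj
      simp [hj]
  rw [lintegral_zero] at key
  have h2 := (ENNReal.continuous_rpow_const (y := 1 / 2)).tendsto 0 |>.comp key
  rw [ENNReal.zero_rpow_of_pos (by norm_num)] at h2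
  refine h2.congr fun j => ?_
  rw [eLpNorm_eq_lintegral_rpow_enorm_toReal (by norm_num) (by norm_num)]
  simp

/-- A smooth function that vanishes on the unit sphere belongs to `H₀¹` of the unit ball. -/
lemma isH10_of_contDiff {g : E N → ℂ} (hg : ContDiff ℝ ∞ g)
    (h0 : ∀ x : E N, ‖x‖ = 1 → g x = 0) :
    IsH10 (Om N 1) g fun i => partialDeriv i g := by
  refine ⟨isH1_of_contDiff hg, fun j x => g x * (cutoff j x : ℂ),
    fun j => isTestFunction_mul_cutoff hg j, ?_, fun i => ?_⟩
  · obtain ⟨B, -, hB⟩ := exists_norm_le_on_Om hg.continuous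
    refine tendsto_eLpNorm_two_zero_of_bounded (C := B + B)
      (fun j => (contDiff_mul_cutoff hg j).continuous) hg.continuous (fun j x hx => ?_)
      (fun x hx => (eventually_mul_cutoff_eq hg hx).mono fun j hj => hj.1)
    exact (norm_sub_le _ _).trans
      (add_le_add (hB x hx) ((norm_mul_cutoff_le g j x).trans (hB x hx)))
  · obtain ⟨B, -, hB⟩ := exists_norm_le_on_Om (contDiff_partialDeriv hg i).continuous
    obtain ⟨C, -, hC⟩ := exists_norm_partialDeriv_mul_cutoff_le hg i h0
    exact tendsto_eLpNorm_two_zero_of_bounded (C := B + C)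
      (fun j => (contDiff_partialDeriv (contDiff_mul_cutoff hg j) i).continuous)
      (contDiff_partialDeriv hg i).continuous
      (fun j x hx => (norm_sub_le _ _).trans (add_le_add (hB x hx) (hC j x hx)))
      (fun x hx => (eventually_mul_cutoff_eq hg hx).mono fun j hj => hj.2 i)

/-- Integration by parts of an `H¹` function against a smooth function that vanishes on the
boundary of the ball. -/
lemma setIntegral_partialDeriv_mul_of_isH1 {g φ : E N → ℂ} {G : Fin N → E N → ℂ}
    (hg : ContDiff ℝ ∞ g) (h0 : ∀ x : E N, ‖x‖ = 1 → g x = 0) (hφ : IsH1 (Om N 1) φ G)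
    (i : Fin N) :
    ∫ x in Om N 1, partialDeriv i g x * φ x = -∫ x in Om N 1, g x * G i x := by
  have lim : ∀ {f ψ : E N → ℂ} {F : ℕ → E N → ℂ} {C : ℝ}, (∀ j, Continuous (F j)) →
      (∀ j, ∀ x ∈ Om N 1, ‖F j x‖ ≤ C) → (∀ x ∈ Om N 1, ∀ᶠ j in atTop, F j x = f x) →
      MemLp ψ 2 (volume.restrict (Om N 1)) →
      Tendsto (fun j => ∫ x in Om N 1, ψ x * F j x) atTop (𝓝 (∫ x in Om N 1, ψ x * f x)) := by
    intro f ψ F C hF hC h hψ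
    refine tendsto_integral_of_dominated_convergence (fun x => ‖ψ x‖ * C)
      (fun j => hψ.1.mul (hF j).aestronglyMeasurable)
      ((hψ.integrable (by norm_num)).norm.mul_const C) (fun j => ?_) ?_
    · refine (ae_restrict_iff' measurableSet_ball).2 (ae_of_all _ fun x hx => ?_)
      rw [norm_mul]
      gcongr
      exact hC j x hx
    · refine (ae_restrict_iff' measurableSet_ball).2 (ae_of_all _ fun x hx => ?_)
      refine tendsto_const_nhds.congr' ?_
      filter_upwards [h x hx] with j hj
      rw [hj]
  obtain ⟨B, -, hB⟩ := exists_norm_le_on_Om hg.continuous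
  obtain ⟨C, -, hC⟩ := exists_norm_partialDeriv_mul_cutoff_le hg i h0
  have h1 := lim (f := partialDeriv i g)
    (fun j => (contDiff_partialDeriv (contDiff_mul_cutoff hg j) i).continuous) hC
    (fun x hx => (eventually_mul_cutoff_eq hg hx).mono fun j hj => hj.2 i) hφ.memL2
  have h2 := lim (f := g) (fun j => (contDiff_mul_cutoff hg j).continuous)
    (fun j x hx => (norm_mul_cutoff_le g j x).trans (hB x hx))
    (fun x hx => (eventually_mul_cutoff_eq hg hx).mono fun j hj => hj.1) (hφ.grad_memL2 i)
  have h3 := h2.neg.congr fun j => (hφ.weak i _ (isTestFunction_mul_cutoff hg j)).symm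
  simp_rw [mul_comm (partialDeriv i g _), mul_comm (g _)]
  exact tendsto_nhds_unique h1 h3

/-- Classical smooth solutions of the transmission problem are transmission eigenfunctions. -/
theorem isEigenpair_of_contDiff {n k : ℝ} {w v : E N → ℂ} (hk : 0 < k)
    (hw : ContDiff ℝ ∞ w) (hv : ContDiff ℝ ∞ v)
    (hΔw : ∀ x, ∑ i, partialDeriv i (partialDeriv i w) x = -(((k * n : ℝ) : ℂ) ^ 2 * w x))
    (hΔv : ∀ x, ∑ i, partialDeriv i (partialDeriv i v) x = -((k : ℂ) ^ 2 * v x))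
    (h0 : ∀ x, ‖x‖ = 1 → w x = v x)
    (h1 : ∀ i x, ‖x‖ = 1 → partialDeriv i w x = partialDeriv i v x)
    (hne : ∃ x ∈ Om N 1, w x ≠ 0) : IsEigenpair (Om N 1) n k w v := by
  have hu : ContDiff ℝ ∞ fun x => w x - v x := hw.sub hv
  refine ⟨hk, fun i => partialDeriv i w, fun i => partialDeriv i v, isH1_of_contDiff hw,
    isH1_of_contDiff hv, weakHelmholtz_of_contDiff hw hΔw, weakHelmholtz_of_contDiff hv hΔv,
    ?_, ?_, ?_⟩
  · have h := isH10_of_contDiff hu fun x hx => sub_eq_zero.2 (h0 x hx)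
    simp_rw [partialDeriv_sub hw hv] at h
    exact h
  · intro φ G hφ
    have hI : ∀ {f : E N → ℂ} {κ : ℝ}, ContDiff ℝ ∞ f →
        Integrable (fun x => (∑ i, partialDeriv i f x * G i x) - (κ : ℂ) ^ 2 * (f x * φ x))
          (volume.restrict (Om N 1)) := fun hf =>
      (integrable_finsetSum _ fun i _ => integrable_mul_of_continuous_of_memLp
        (contDiff_partialDeriv hf i).continuous (hφ.grad_memL2 i)).sub
        ((integrable_mul_of_continuous_of_memLp hf.continuous hφ.memL2).const_mul _)
    rw [← sub_eq_zero, ← integral_sub (hI hw) (hI hv)]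
    have hgi : ∀ i, ContDiff ℝ ∞ fun x => partialDeriv i w x - partialDeriv i v x := fun i =>
      (contDiff_partialDeriv hw i).sub (contDiff_partialDeriv hv i)
    have hb : ∀ i, ∫ x in Om N 1, ((partialDeriv i w x - partialDeriv i v x) * G i x +
        partialDeriv i (fun x => partialDeriv i w x - partialDeriv i v x) x * φ x) = 0 := by
      intro i
      rw [integral_add
        (integrable_mul_of_continuous_of_memLp (hgi i).continuous (hφ.grad_memL2 i))
        (integrable_mul_of_continuous_of_memLp (contDiff_partialDeriv (hgi i) i).continuous
          hφ.memL2),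
        setIntegral_partialDeriv_mul_of_isH1 (hgi i) (fun x hx => sub_eq_zero.2 (h1 i x hx)) hφ i,
        add_neg_cancel]
    have hb' := integral_finsetSum (μ := volume.restrict (Om N 1)) Finset.univ fun i _ =>
      (integrable_mul_of_continuous_of_memLp (hgi i).continuous (hφ.grad_memL2 i)).add
        (integrable_mul_of_continuous_of_memLp (contDiff_partialDeriv (hgi i) i).continuous
          hφ.memL2)
    simp only [Pi.add_apply, hb, Finset.sum_const_zero] at hb'
    rw [← hb']
    refine integral_congr_ae (ae_of_all _ fun x => ?_)
    have hd := fun i => partialDeriv_sub (contDiff_partialDeriv hw i) (contDiff_partialDeriv hv i) i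
    simp only [hd, Finset.sum_add_distrib, sub_mul, Finset.sum_sub_distrib, ← Finset.sum_mul,
      hΔw, hΔv]
    ring
  · rintro ⟨hw0, -⟩
    obtain ⟨x, hx, hx0⟩ := hne
    exact hx0 (Measure.eqOn_open_of_ae_eq hw0 Metric.isOpen_ball hw.continuous.continuousOn
      continuousOn_const hx)

/-! ### Separated modes -/

/-- The function on `ℝ^N` defined by a complex polynomial. -/
noncomputable def polyEval (P : MvPolynomial (Fin N) ℂ) (x : E N) : ℂ :=
  MvPolynomial.eval (fun i => (x i : ℂ)) P

lemma contDiff_coord (i : Fin N) : ContDiff ℝ ∞ fun x : E N => (x i : ℂ) :=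
  Complex.ofRealCLM.contDiff.comp (EuclideanSpace.proj (𝕜 := ℝ) i).contDiff

lemma contDiff_polyEval (P : MvPolynomial (Fin N) ℂ) : ContDiff ℝ ∞ (polyEval P) := by
  induction P using MvPolynomial.induction_on with
  | C a =>
    have : polyEval (N := N) (MvPolynomial.C a) = fun _ => a := by ext; simp [polyEval]
    exact this ▸ contDiff_const
  | add p q hp hq =>
    have : polyEval (p + q) = fun x => polyEval p x + polyEval q x := by ext; simp [polyEval]
    exact this ▸ hp.add hq
  | mul_X p i hp =>
    have : polyEval (p * MvPolynomial.X i) = fun x => polyEval p x * (x i : ℂ) := by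
      ext; simp [polyEval]
    exact this ▸ hp.mul (contDiff_coord i)

lemma partialDeriv_add {f g : E N → ℂ} (hf : ContDiff ℝ ∞ f) (hg : ContDiff ℝ ∞ g) (i : Fin N) :
    partialDeriv i (fun x => f x + g x) = fun x => partialDeriv i f x + partialDeriv i g x := by
  ext x
  have := fderiv_fun_add (𝕜 := ℝ) (hf.differentiable (by simp) x) (hg.differentiable (by simp) x)
  simp [partialDeriv, this]

lemma partialDeriv_coord (i j : Fin N) (x : E N) :
    partialDeriv i (fun x : E N => (x j : ℂ)) x = (Pi.single i 1 : Fin N → ℂ) j := by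
  have h := (Complex.ofRealCLM.comp (EuclideanSpace.proj (𝕜 := ℝ) j)).hasFDerivAt (x := x)
  have h2 : fderiv ℝ (fun x : E N => (x j : ℂ)) x
      = Complex.ofRealCLM.comp (EuclideanSpace.proj (𝕜 := ℝ) j) := h.fderiv
  rw [partialDeriv, h2]
  by_cases hij : j = i
  · subst hij; simp
  · simp [hij]

lemma partialDeriv_polyEval (i : Fin N) (P : MvPolynomial (Fin N) ℂ) :
    partialDeriv i (polyEval P) = polyEval (MvPolynomial.pderiv i P) := by
  induction P using MvPolynomial.induction_on with
  | C a =>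
    ext x
    have : polyEval (N := N) (MvPolynomial.C a) = fun _ => a := by ext; simp [polyEval]
    simp [this, partialDeriv, polyEval]
  | add p q hp hq =>
    have : polyEval (p + q) = fun x => polyEval p x + polyEval q x := by ext; simp [polyEval]
    rw [this, partialDeriv_add (contDiff_polyEval p) (contDiff_polyEval q), hp, hq]
    ext
    simp [polyEval]
  | mul_X p j hp =>
    have : polyEval (p * MvPolynomial.X j) = fun x => polyEval p x * (x j : ℂ) := by
      ext; simp [polyEval]
    rw [this, partialDeriv_mul (contDiff_polyEval p) (contDiff_coord j), hp]
    ext x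
    rw [partialDeriv_coord]
    by_cases hij : j = i
    · subst hij; simp [polyEval, MvPolynomial.pderiv_X]; ring
    · simp [polyEval, MvPolynomial.pderiv_X, hij]; ring

lemma polyEval_smul {P : MvPolynomial (Fin N) ℂ} {m : ℕ} (hP : P.IsHomogeneous m) (r : ℝ)
    (x : E N) : polyEval P (r • x) = (r : ℂ) ^ m * polyEval P x := by
  rw [polyEval, polyEval, MvPolynomial.eval_eq', MvPolynomial.eval_eq', Finset.mul_sum]
  refine Finset.sum_congr rfl fun d hd => ?_
  have hdeg : ∑ i, d i = m := by
    have := hP (MvPolynomial.mem_support_iff.1 hd)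
    rw [Finsupp.weight_apply, Finsupp.sum_fintype _ _ (by simp)] at this
    simpa using this
  simp only [PiLp.smul_apply, smul_eq_mul, Complex.ofReal_mul, mul_pow, Finset.prod_mul_distrib,
    Finset.prod_pow_eq_pow_sum, hdeg]
  ring

/-- The mode `P(x) F_ν(κ² |x|² / 4)`. If `P` is harmonic and homogeneous of degree `m` and
`ν = m + N / 2 - 1`, it is a smooth solution of the Helmholtz equation on all of `ℝ^N`, proportional
to `|x|^{1 - N / 2} J_ν(κ |x|) P(x / |x|)`. -/
noncomputable def mode (P : MvPolynomial (Fin N) ℂ) (ν κ : ℝ) (x : E N) : ℂ :=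
  polyEval P x * (besselEntire ν (κ ^ 2 / 4 * ‖x‖ ^ 2) : ℂ)

lemma contDiff_besselEntire_norm_sq {ν : ℝ} (hν : 0 ≤ ν) (κ : ℝ) :
    ContDiff ℝ ∞ fun x : E N => (besselEntire ν (κ ^ 2 / 4 * ‖x‖ ^ 2) : ℂ) :=
  Complex.ofRealCLM.contDiff.comp
    ((contDiff_besselEntire hν).comp (contDiff_const.mul (contDiff_norm_sq ℝ)))

lemma contDiff_mode (P : MvPolynomial (Fin N) ℂ) {ν : ℝ} (hν : 0 ≤ ν) (κ : ℝ) :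
    ContDiff ℝ ∞ (mode P ν κ) :=
  (contDiff_polyEval P).mul (contDiff_besselEntire_norm_sq hν κ)

lemma partialDeriv_mode (P : MvPolynomial (Fin N) ℂ) {ν : ℝ} (hν : 0 ≤ ν) (κ : ℝ) (i : Fin N) :
    partialDeriv i (mode P ν κ) = fun x => mode (MvPolynomial.pderiv i P) ν κ x +
      mode (MvPolynomial.C (-((κ : ℂ) ^ 2 / 2)) * (MvPolynomial.X i * P)) (ν + 1) κ x := by
  have h : mode P ν κ = fun x => polyEval P x * (besselEntire ν (κ ^ 2 / 4 * ‖x‖ ^ 2) : ℂ) := rfl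
  rw [h, partialDeriv_mul (contDiff_polyEval P) (contDiff_besselEntire_norm_sq hν κ),
    partialDeriv_polyEval]
  ext x
  have hd : ∀ s : ℝ, HasDerivAt (fun s : ℝ => besselEntire ν (κ ^ 2 / 4 * s))
      (-besselEntire (ν + 1) (κ ^ 2 / 4 * s) * (κ ^ 2 / 4)) s := by
    intro s
    have h1 : HasDerivAt (fun s : ℝ => κ ^ 2 / 4 * s) (κ ^ 2 / 4) s := by
      simpa using (hasDerivAt_id s).const_mul (κ ^ 2 / 4)
    exact (hasDerivAt_besselEntire hν _).comp s h1
  have := partialDeriv_norm_sq_comp (N := N) (fun s => (hd s).differentiableAt) i x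
  rw [(hd _).deriv] at this
  rw [this]
  simp only [mode, polyEval, map_mul, MvPolynomial.eval_C, MvPolynomial.eval_X]
  push_cast
  ring

lemma laplacian_mode {P : MvPolynomial (Fin N) ℂ} {m : ℕ} (hP : P.IsHomogeneous m)
    (hΔ : ∑ i, MvPolynomial.pderiv i (MvPolynomial.pderiv i P) = 0) {ν : ℝ} (hν : 0 ≤ ν)
    (hνm : ν + 1 = m + N / 2) (κ : ℝ) (x : E N) :
    ∑ i, partialDeriv i (partialDeriv i (mode P ν κ)) x = -((κ : ℂ) ^ 2 * mode P ν κ x) := by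
  have h1 : ∑ i, polyEval (MvPolynomial.pderiv i (MvPolynomial.pderiv i P)) x = 0 := by
    simp only [polyEval, ← map_sum, hΔ, map_zero]
  have h2 : ∑ i, (x i : ℂ) * polyEval (MvPolynomial.pderiv i P) x = m * polyEval P x := by
    have := congrArg (MvPolynomial.eval fun i => (x i : ℂ)) hP.sum_X_mul_pderiv
    simpa [polyEval] using this
  have h3 : ∑ i, (x i : ℂ) ^ 2 = (‖x‖ : ℂ) ^ 2 := by
    have := EuclideanSpace.real_norm_sq_eq x
    exact_mod_cast this.symm
  have hν1 : (0 : ℝ) ≤ ν + 1 := by linarith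
  have h4 : ∀ i, partialDeriv i (partialDeriv i (mode P ν κ)) x =
      polyEval (MvPolynomial.pderiv i (MvPolynomial.pderiv i P)) x *
          (besselEntire ν (κ ^ 2 / 4 * ‖x‖ ^ 2) : ℂ)
        - (κ : ℂ) ^ 2 * (besselEntire (ν + 1) (κ ^ 2 / 4 * ‖x‖ ^ 2) : ℂ) *
          ((x i : ℂ) * polyEval (MvPolynomial.pderiv i P) x)
        - (κ : ℂ) ^ 2 / 2 * (besselEntire (ν + 1) (κ ^ 2 / 4 * ‖x‖ ^ 2) : ℂ) * polyEval P x
        + (κ : ℂ) ^ 4 / 4 * (besselEntire (ν + 1 + 1) (κ ^ 2 / 4 * ‖x‖ ^ 2) : ℂ) * polyEval P x *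
          (x i : ℂ) ^ 2 := by
    intro i
    rw [partialDeriv_mode P hν, partialDeriv_add (contDiff_mode _ hν κ) (contDiff_mode _ hν1 κ),
      partialDeriv_mode _ hν, partialDeriv_mode _ hν1]
    simp only [mode, polyEval, map_mul, map_add, Derivation.leibniz, MvPolynomial.pderiv_C,
      MvPolynomial.pderiv_X_self, smul_eq_mul, MvPolynomial.eval_C, MvPolynomial.eval_X, mul_zero,
      map_one, map_zero]
    ring
  have h5 := besselEntire_sub_one (ν := ν + 1) (by linarith) (κ ^ 2 / 4 * ‖x‖ ^ 2)
  rw [add_sub_cancel_right, hνm] at h5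
  rw [← hνm] at h5
  have h6 : (besselEntire ν (κ ^ 2 / 4 * ‖x‖ ^ 2) : ℂ) =
      (m + N / 2) * (besselEntire (ν + 1) (κ ^ 2 / 4 * ‖x‖ ^ 2) : ℂ) -
      (κ : ℂ) ^ 2 / 4 * (‖x‖ : ℂ) ^ 2 * (besselEntire (ν + 1 + 1) (κ ^ 2 / 4 * ‖x‖ ^ 2) : ℂ) := by
    rw [h5]
    have := congrArg (fun t : ℝ => (t : ℂ)) hνm
    push_cast at this ⊢
    rw [this]
  simp only [h4, Finset.sum_add_distrib, Finset.sum_sub_distrib, ← Finset.sum_mul,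
    ← Finset.mul_sum, h1, h2, h3, Finset.sum_const, Finset.card_univ, Fintype.card_fin,
    nsmul_eq_mul, mode, h6]
  ring

lemma mode_C_mul (a : ℂ) (P : MvPolynomial (Fin N) ℂ) (ν κ : ℝ) (x : E N) :
    mode (MvPolynomial.C a * P) ν κ x = a * mode P ν κ x := by
  simp [mode, polyEval, mul_assoc]

lemma exists_mode_ne_zero {P : MvPolynomial (Fin N) ℂ} {m : ℕ} (hP : P.IsHomogeneous m)
    (hP0 : ∃ x : E N, ‖x‖ = 1 ∧ polyEval P x ≠ 0) {ν : ℝ} (hν : 0 ≤ ν) (κ : ℝ) :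
    ∃ x ∈ Om N 1, mode P ν κ x ≠ 0 := by
  obtain ⟨x, hx, hx0⟩ := hP0
  have h1 : ContinuousAt (fun r : ℝ => besselEntire ν (κ ^ 2 / 4 * r ^ 2)) 0 :=
    ((contDiff_besselEntire hν).continuous.comp (by fun_prop)).continuousAt
  have h2 := h1.eventually (lt_mem_nhds (a := 0) (by simpa using besselEntire_zero_pos hν))
  obtain ⟨r, hr, hr0, hr1⟩ := ((h2.filter_mono nhdsWithin_le_nhds).and
    (Ioo_mem_nhdsGT (zero_lt_one' ℝ))).exists
  have hn : ‖r • x‖ = r := by rw [norm_smul, hx, mul_one, Real.norm_eq_abs, abs_of_pos hr0]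
  refine ⟨r • x, mem_Om_one.2 (hn.trans_lt hr1), ?_⟩
  rw [mode, polyEval_smul hP, hn]
  refine mul_ne_zero (mul_ne_zero (pow_ne_zero _ ?_) hx0) ?_
  · exact_mod_cast hr0.ne'
  · exact_mod_cast hr.ne'

/-- Two modes over the same harmonic polynomial whose radial parts agree to first order at `r = 1`
are transmission eigenfunctions. -/
theorem isEigenpair_mode {P : MvPolynomial (Fin N) ℂ} {m : ℕ} (hP : P.IsHomogeneous m)
    (hΔ : ∑ i, MvPolynomial.pderiv i (MvPolynomial.pderiv i P) = 0)
    (hP0 : ∃ x : E N, ‖x‖ = 1 ∧ polyEval P x ≠ 0) {ν : ℝ} (hν : 0 ≤ ν)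
    (hνm : ν + 1 = m + N / 2) {n k a b : ℝ} (hk : 0 < k) (ha : a ≠ 0)
    (h0 : a * besselEntire ν ((k * n) ^ 2 / 4) = b * besselEntire ν (k ^ 2 / 4))
    (h1 : a * ((k * n) ^ 2 * besselEntire (ν + 1) ((k * n) ^ 2 / 4)) =
      b * (k ^ 2 * besselEntire (ν + 1) (k ^ 2 / 4))) :
    IsEigenpair (Om N 1) n k (mode (MvPolynomial.C (a : ℂ) * P) ν (k * n))
      (mode (MvPolynomial.C (b : ℂ) * P) ν k) := by
  have hC : ∀ c : ℂ, (MvPolynomial.C c * P).IsHomogeneous m := fun c => by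
    simpa using (MvPolynomial.isHomogeneous_C (Fin N) c).mul hP
  have hCΔ : ∀ c : ℂ,
      ∑ i, MvPolynomial.pderiv i (MvPolynomial.pderiv i (MvPolynomial.C c * P)) = 0 := fun c => by
    simp [Derivation.leibniz, ← Finset.mul_sum, hΔ]
  have h0' : (a : ℂ) * (besselEntire ν ((k * n) ^ 2 / 4) : ℂ) =
      b * (besselEntire ν (k ^ 2 / 4) : ℂ) := by exact_mod_cast h0
  have h1' : (a : ℂ) * (((k * n : ℝ) : ℂ) ^ 2 * (besselEntire (ν + 1) ((k * n) ^ 2 / 4) : ℂ)) =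
      b * ((k : ℂ) ^ 2 * (besselEntire (ν + 1) (k ^ 2 / 4) : ℂ)) := by exact_mod_cast h1
  refine isEigenpair_of_contDiff hk (contDiff_mode _ hν _) (contDiff_mode _ hν _)
    (laplacian_mode (hC _) (hCΔ _) hν hνm _) (laplacian_mode (hC _) (hCΔ _) hν hνm _)
    (fun x hx => ?_) (fun i x hx => ?_) ?_
  · rw [mode_C_mul, mode_C_mul]
    simp only [mode, hx, one_pow, mul_one]
    linear_combination polyEval P x * h0'
  · rw [partialDeriv_mode _ hν, partialDeriv_mode _ hν]
    simp only [Derivation.leibniz, MvPolynomial.pderiv_C, mul_zero, add_zero, smul_eq_mul,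
      mode, hx, one_pow, mul_one, polyEval, map_mul, MvPolynomial.eval_C, MvPolynomial.eval_X]
    linear_combination MvPolynomial.eval (fun i => (x i : ℂ)) (MvPolynomial.pderiv i P) * h0' -
      1 / 2 * (x i : ℂ) * MvPolynomial.eval (fun i => (x i : ℂ)) P * h1'
  · exact exists_mode_ne_zero (hC _) (by
      obtain ⟨x, hx, hx0⟩ := hP0
      refine ⟨x, hx, ?_⟩
      simpa [polyEval, ha] using hx0) hν _

/-- Radial amplitudes `R(t) = c (t / 2)^m F_ν(t² / 4)` matched at a zero of the characteristic
function produce transmission eigenfunctions. -/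
theorem isEigenpair_of_charFun_eq_zero {P : MvPolynomial (Fin N) ℂ} {m : ℕ}
    (hP : P.IsHomogeneous m)
    (hΔ : ∑ i, MvPolynomial.pderiv i (MvPolynomial.pderiv i P) = 0)
    (hP0 : ∃ x : E N, ‖x‖ = 1 ∧ polyEval P x ≠ 0) {ν : ℝ} (hν : 1 ≤ ν)
    (hνm : ν + 1 = m + N / 2) {n k c β : ℝ} {R : ℝ → ℝ} (hn : 0 < n) (hk : 0 < k) (hc : c ≠ 0)
    (hR : ∀ t, 0 < t → R t = c * (t / 2) ^ m * besselEntire ν (t ^ 2 / 4))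
    (h0 : R k ≠ 0) (hβ : β = R (k * n) / R k) (hf : charFun n ν k = 0) :
    IsEigenpair (Om N 1) n k
      (mode (MvPolynomial.C ((c * (k * n / 2) ^ m : ℝ) : ℂ) * P) ν (k * n))
      (mode (MvPolynomial.C ((β * (c * (k / 2) ^ m) : ℝ) : ℂ) * P) ν k) := by
  have hkn : 0 < k * n := by positivity
  have hm := besselEntire_matching hn hν hk hf
  have hβR : β * R k = R (k * n) := by rw [hβ, div_mul_cancel₀ _ h0]
  rw [hR _ hk, hR _ hkn] at hβR
  have hF : besselEntire ν (k ^ 2 / 4) ≠ 0 := by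
    rw [hR _ hk] at h0
    exact right_ne_zero_of_mul h0
  refine isEigenpair_mode hP hΔ hP0 (by linarith) hνm hk (mul_ne_zero hc (by positivity)) ?_ ?_
  · linear_combination -hβR
  · refine mul_right_cancel₀ hF ?_
    linear_combination c * (k * n / 2) ^ m * k ^ 2 * hm
      - k ^ 2 * besselEntire (ν + 1) (k ^ 2 / 4) * hβR

/-! ### The planar and spatial modes -/

/-- The harmonic polynomial `(x₀ + i x₁)^m` in dimension two. -/
noncomputable def planarHarmonic (m : ℕ) : MvPolynomial (Fin 2) ℂ :=
  (MvPolynomial.X 0 + MvPolynomial.C Complex.I * MvPolynomial.X 1) ^ m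

/-- The harmonic polynomial `(x₀ + i x₁)^m` in dimension three. -/
noncomputable def sectorialHarmonic (m : ℕ) : MvPolynomial (Fin 3) ℂ :=
  (MvPolynomial.X 0 + MvPolynomial.C Complex.I * MvPolynomial.X 1) ^ m

lemma isHomogeneous_isotropic_pow {i j : Fin N} (m : ℕ) :
    ((MvPolynomial.X i + MvPolynomial.C Complex.I * MvPolynomial.X j) ^ m :
      MvPolynomial (Fin N) ℂ).IsHomogeneous m := by
  have h : (MvPolynomial.X i + MvPolynomial.C Complex.I * MvPolynomial.X j :
      MvPolynomial (Fin N) ℂ).IsHomogeneous 1 := by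
    refine (MvPolynomial.isHomogeneous_X ℂ i).add ?_
    simpa using (MvPolynomial.isHomogeneous_C (Fin N) Complex.I).mul
      (MvPolynomial.isHomogeneous_X ℂ j)
  simpa using h.pow m

/-- Powers of a linear form with isotropic gradient are harmonic. -/
lemma laplacian_pow {L : MvPolynomial (Fin N) ℂ} {d : Fin N → ℂ}
    (hd : ∀ i, MvPolynomial.pderiv i L = MvPolynomial.C (d i)) (hd0 : ∑ i, d i ^ 2 = 0) (m : ℕ) :
    ∑ i, MvPolynomial.pderiv i (MvPolynomial.pderiv i (L ^ m)) = 0 := by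
  have h : ∀ i, MvPolynomial.pderiv i (MvPolynomial.pderiv i (L ^ m)) =
      ((m : MvPolynomial (Fin N) ℂ) * (((m - 1 : ℕ) : MvPolynomial (Fin N) ℂ) *
        L ^ (m - 1 - 1))) * MvPolynomial.C (d i ^ 2) := by
    intro i
    simp only [Derivation.leibniz_pow, Derivation.leibniz, hd, MvPolynomial.pderiv_C, smul_eq_mul,
      nsmul_eq_mul, map_pow, Derivation.map_natCast, mul_zero, zero_add, add_zero]
    ring
  rw [Finset.sum_congr rfl fun i _ => h i, ← Finset.mul_sum, ← map_sum, hd0, map_zero, mul_zero]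

lemma laplacian_planarHarmonic (m : ℕ) :
    ∑ i, MvPolynomial.pderiv i (MvPolynomial.pderiv i (planarHarmonic m)) = 0 := by
  refine laplacian_pow (d := ![1, Complex.I]) (fun i => ?_) (by simp [Fin.sum_univ_two]) m
  fin_cases i <;> simp [Derivation.leibniz, MvPolynomial.pderiv_X]

lemma laplacian_sectorialHarmonic (m : ℕ) :
    ∑ i, MvPolynomial.pderiv i (MvPolynomial.pderiv i (sectorialHarmonic m)) = 0 := by
  refine laplacian_pow (d := ![1, Complex.I, 0]) (fun i => ?_) (by simp [Fin.sum_univ_three]) m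
  fin_cases i <;> simp [Derivation.leibniz, MvPolynomial.pderiv_X]

lemma planarMode_eq_mode {m : ℕ} (hm : 1 ≤ m) {κ : ℝ} (hκ : 0 < κ) :
    planarMode m κ = mode (MvPolynomial.C ((1 * (κ / 2) ^ m : ℝ) : ℂ) * planarHarmonic m) m κ := by
  ext x
  set z : ℂ := ⟨x 0, x 1⟩ with hz
  have hz1 : z = (x 0 : ℂ) + Complex.I * (x 1 : ℂ) := by
    rw [mul_comm]; exact (Complex.mk_eq_add_mul_I _ _)
  have hzn : ‖z‖ = ‖x‖ := by
    rw [EuclideanSpace.norm_eq, Complex.norm_eq_sqrt_sq_add_sq, Fin.sum_univ_two]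
    simp [hz]
  have hpe : polyEval (planarHarmonic m) x = z ^ m := by
    simp [polyEval, planarHarmonic, hz1]
  rw [mode_C_mul, mode, hpe, planarMode, ← hz]
  rcases eq_or_ne x 0 with rfl | hx
  · have h0 : z = 0 := by rw [← norm_eq_zero, hzn, norm_zero]
    rw [h0, zero_pow (by omega), norm_zero, mul_zero, besselJ_zero (by exact_mod_cast hm)]
    simp
  · have hxn : 0 < ‖x‖ := norm_pos_iff.2 hx
    have hpol : z ^ m = (‖x‖ : ℂ) ^ m * Complex.exp (Complex.I * m * (z.arg : ℂ)) := by
      conv_lhs => rw [← Complex.norm_mul_exp_arg_mul_I z, hzn, mul_pow, ← Complex.exp_nat_mul]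
      congr 2
      ring
    rw [hpol, besselJ_eq (by positivity), Real.rpow_natCast,
      show (κ * ‖x‖) ^ 2 / 4 = κ ^ 2 / 4 * ‖x‖ ^ 2 by ring]
    push_cast
    ring

lemma sphericalBessel_eq {m : ℕ} {t : ℝ} (ht : 0 < t) :
    sphericalBessel m t = Real.sqrt Real.pi / 2 * (t / 2) ^ m *
      besselEntire (m + 1 / 2) (t ^ 2 / 4) := by
  have h : Real.sqrt (Real.pi / (2 * t)) * Real.sqrt (t / 2) = Real.sqrt Real.pi / 2 := by
    rw [← Real.sqrt_mul (by positivity), show Real.pi / (2 * t) * (t / 2) = Real.pi / 2 ^ 2 by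
      field_simp, Real.sqrt_div Real.pi_pos.le, Real.sqrt_sq (by norm_num)]
  rw [sphericalBessel, besselJ_eq ht, Real.rpow_add (by positivity), Real.rpow_natCast,
    ← Real.sqrt_eq_rpow, ← h]
  ring

lemma spatialMode_eq_mode {m : ℕ} (hm : 1 ≤ m) {κ : ℝ} (hκ : 0 < κ) {Y : E 3 → ℂ}
    {P : MvPolynomial (Fin 3) ℂ} (hP : P.IsHomogeneous m)
    (hY : ∀ x ∈ Metric.sphere (0 : E 3) 1, Y x = polyEval P x) :
    spatialMode m κ Y = mode (MvPolynomial.C ((Real.sqrt Real.pi / 2 * (κ / 2) ^ m : ℝ) : ℂ) * P)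
      (m + 1 / 2) κ := by
  ext x
  rw [mode_C_mul, mode, spatialMode]
  rcases eq_or_ne x 0 with rfl | hx
  · have h0 : polyEval P (0 : E 3) = 0 := by
      have := polyEval_smul hP 0 (0 : E 3)
      rwa [smul_zero, Complex.ofReal_zero, zero_pow (by omega), zero_mul] at this
    rw [h0, norm_zero, mul_zero, sphericalBessel, besselJ_zero (by positivity)]
    simp
  · have hxn : 0 < ‖x‖ := norm_pos_iff.2 hx
    have hsph : ‖x‖⁻¹ • x ∈ Metric.sphere (0 : E 3) 1 := by
      rw [mem_sphere_zero_iff_norm, norm_smul, norm_inv, norm_norm, inv_mul_cancel₀ hxn.ne']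
    have hPx : polyEval P x = (‖x‖ : ℂ) ^ m * Y (‖x‖⁻¹ • x) := by
      rw [hY _ hsph, ← polyEval_smul hP, smul_smul, mul_inv_cancel₀ hxn.ne', one_smul]
    rw [hPx, sphericalBessel_eq (by positivity),
      show (κ * ‖x‖) ^ 2 / 4 = κ ^ 2 / 4 * ‖x‖ ^ 2 by ring]
    push_cast
    ring

/-! ### Localization by dilation -/

/-- Pointwise growth by a factor `A` under the dilation `x ↦ l x` gives decay of `L²` norms by the
factor `A⁻¹` from the unit ball to the ball of radius `τ`. -/
lemma mul_l2norm_le {ψ : E N → ℂ} (hψ : Continuous ψ) {τ l A : ℝ} (hl : 1 ≤ l) (hlτ : l * τ ≤ 1)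
    (hA : 0 ≤ A) (h : ∀ x ∈ Om N τ, A * ‖ψ x‖ ≤ ‖ψ (l • x)‖) :
    A * l2norm τ ψ ≤ l2norm 1 ψ := by
  have hl0 : 0 < l := by linarith
  have hf : Measurable fun x : E N => l • x := measurable_const_smul l
  have hpre : Om N τ = (fun x : E N => l • x) ⁻¹' Om N (l * τ) := by
    ext x
    simp [Om, norm_smul, abs_of_pos hl0, hl0]
  have hmap : (volume.restrict (Om N τ)).map (fun x : E N => l • x) ≤
      volume.restrict (Om N 1) := by
    have hball : MeasurableSet (Om N (l * τ)) := measurableSet_ball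
    rw [hpre, ← Measure.restrict_map hf hball, Measure.map_addHaar_smul _ hl0.ne']
    refine Measure.restrict_mono' (Metric.ball_subset_ball hlτ).eventuallyLE ?_
    intro s
    rw [Measure.smul_apply, smul_eq_mul]
    refine mul_le_of_le_one_left zero_le ?_
    rw [ENNReal.ofReal_le_one, abs_of_pos (by positivity)]
    exact inv_le_one_of_one_le₀ (one_le_pow₀ hl)
  have h1 : eLpNorm (fun x => A • ψ x) 2 (volume.restrict (Om N τ)) ≤
      eLpNorm ψ 2 (volume.restrict (Om N 1)) := by
    calc eLpNorm (fun x => A • ψ x) 2 (volume.restrict (Om N τ))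
        ≤ eLpNorm (ψ ∘ fun x : E N => l • x) 2 (volume.restrict (Om N τ)) := by
          refine eLpNorm_mono_ae ((ae_restrict_iff' measurableSet_ball).2
            (ae_of_all _ fun x hx => ?_))
          rw [norm_smul, Real.norm_eq_abs, abs_of_nonneg hA]
          exact h x hx
      _ = eLpNorm ψ 2 ((volume.restrict (Om N τ)).map fun x : E N => l • x) :=
          (eLpNorm_map_measure hψ.aestronglyMeasurable hf.aemeasurable).symm
      _ ≤ _ := eLpNorm_mono_measure _ hmap
  have h2 := ENNReal.toReal_mono (memLp_two_of_continuous hψ).eLpNorm_ne_top h1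
  have h3 : eLpNorm (fun x => A • ψ x) 2 (volume.restrict (Om N τ)) =
      ‖A‖ₑ * eLpNorm ψ 2 (volume.restrict (Om N τ)) := eLpNorm_const_smul A ψ 2 _
  rw [h3, ENNReal.toReal_mul, toReal_enorm, Real.norm_eq_abs, abs_of_nonneg hA] at h2
  exact h2

lemma l2norm_one_pos {ψ : E N → ℂ} (hψ : Continuous ψ) (h : ∃ x ∈ Om N 1, ψ x ≠ 0) :
    0 < l2norm 1 ψ := by
  refine ENNReal.toReal_pos (fun h0 => ?_) (memLp_two_of_continuous hψ).eLpNorm_ne_top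
  rw [eLpNorm_eq_zero_iff hψ.aestronglyMeasurable (by norm_num)] at h0
  obtain ⟨x, hx, hx0⟩ := h
  exact hx0 (Measure.eqOn_open_of_ae_eq h0 Metric.isOpen_ball hψ.continuousOn
    continuousOn_const hx)

lemma localizes_of_dilation {ψ : ℕ → E N → ℂ} {τ l : ℝ} {A : ℕ → ℝ} (hl : 1 ≤ l)
    (hlτ : l * τ ≤ 1) (hA : Tendsto A atTop atTop)
    (h : ∀ᶠ m in atTop, Continuous (ψ m) ∧ (∃ x ∈ Om N 1, ψ m x ≠ 0) ∧
      ∀ x ∈ Om N τ, A m * ‖ψ m x‖ ≤ ‖ψ m (l • x)‖) : Localizes τ ψ := by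
  refine ⟨h.mono fun m hm => ⟨memLp_two_of_continuous hm.1, l2norm_one_pos hm.1 hm.2.1⟩, ?_⟩
  refine tendsto_of_tendsto_of_tendsto_of_le_of_le' tendsto_const_nhds hA.inv_tendsto_atTop
    (Eventually.of_forall fun m => div_nonneg ENNReal.toReal_nonneg ENNReal.toReal_nonneg) ?_
  filter_upwards [h, hA.eventually_gt_atTop 0] with m hm hA0
  have h1 := mul_l2norm_le hm.1 hl hlτ hA0.le hm.2.2
  rw [Pi.inv_apply, div_le_iff₀ (l2norm_one_pos hm.1 hm.2.1), inv_mul_eq_div, le_div_iff₀ hA0,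
    mul_comm]
  exact h1

lemma Localizes.comp_add {τ : ℝ} {ψ : ℕ → E N → ℂ} (h : Localizes τ ψ) (d : ℕ) :
    Localizes τ fun m => ψ (m + d) :=
  ⟨(tendsto_add_atTop_nat d).eventually h.1, h.2.comp (tendsto_add_atTop_nat d)⟩

lemma rpow_mul_norm_mode_le {P : MvPolynomial (Fin N) ℂ} {m : ℕ} (hP : P.IsHomogeneous m)
    (hm : 1 ≤ m) {ν κ l c : ℝ} (hν : 1 ≤ ν) (hνm : ν + 1 = m + N / 2) (hκ : 0 < κ) (hl : 1 ≤ l)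
    {x : E N} (hx : (l * (κ * ‖x‖)) ^ 2 + c ^ 2 ≤ ν ^ 2) :
    l ^ (c + 1 - N / 2 : ℝ) * ‖mode P ν κ x‖ ≤ ‖mode P ν κ (l • x)‖ := by
  have hl0 : 0 < l := by linarith
  rcases eq_or_ne x 0 with rfl | hx0
  · have h0 : polyEval P (0 : E N) = 0 := by
      have := polyEval_smul hP 0 (0 : E N)
      rwa [smul_zero, Complex.ofReal_zero, zero_pow (by omega), zero_mul] at this
    simp [mode, h0]
  · have hxn : 0 < ‖x‖ := norm_pos_iff.2 hx0
    have ht : 0 < κ * ‖x‖ := by positivity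
    have h := rpow_mul_abs_besselJ_le hν ht hl hx
    rw [besselJ_eq ht, besselJ_eq (by positivity), abs_mul, abs_mul,
      abs_of_pos (by positivity : 0 < (κ * ‖x‖ / 2) ^ ν),
      abs_of_pos (by positivity : 0 < (l * (κ * ‖x‖) / 2) ^ ν), mul_div_assoc l,
      Real.mul_rpow hl0.le (by positivity)] at h
    have h1 : 0 < (κ * ‖x‖ / 2) ^ ν := by positivity
    have h2 : l ^ c * |besselEntire ν ((κ * ‖x‖) ^ 2 / 4)| ≤
        l ^ ν * |besselEntire ν ((l * (κ * ‖x‖)) ^ 2 / 4)| :=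
      le_of_mul_le_mul_left (by linarith) h1
    have h3 : l ^ (c + 1 - N / 2 : ℝ) = l ^ c * l ^ ((m : ℝ) - ν) := by
      rw [← Real.rpow_add hl0]
      congr 1
      linarith
    have h4 : l ^ ν * l ^ ((m : ℝ) - ν) = l ^ m := by
      rw [← Real.rpow_add hl0, ← Real.rpow_natCast]
      congr 1
      ring
    rw [mode, mode, polyEval_smul hP, norm_mul, norm_mul, norm_mul, norm_pow, Complex.norm_real,
      Complex.norm_real, Complex.norm_real, norm_smul, Real.norm_eq_abs, Real.norm_eq_abs,
      Real.norm_eq_abs, abs_of_pos hl0, h3, ← h4,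
      show κ ^ 2 / 4 * ‖x‖ ^ 2 = (κ * ‖x‖) ^ 2 / 4 by ring,
      show κ ^ 2 / 4 * (l * ‖x‖) ^ 2 = (l * (κ * ‖x‖)) ^ 2 / 4 by ring]
    have h5 : 0 ≤ l ^ ((m : ℝ) - ν) * ‖polyEval P x‖ := by positivity
    have h6 := mul_le_mul_of_nonneg_left h2 h5
    linarith

/-- Modes of degree `m` with wave numbers `κ_m ≤ (1 + o(1)) ν_m` localize at the boundary: inside
the ball of radius `τ < 1` the argument of `J_ν` stays below a fixed fraction of the turning point,
where `J_ν` grows exponentially in `ν` under dilation. -/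
theorem localizes_mode {P : ℕ → MvPolynomial (Fin N) ℂ} {ν κ : ℕ → ℝ} {ψ : ℕ → E N → ℂ}
    (hν : ∀ m : ℕ, ν m + 1 = m + N / 2)
    (h : ∀ᶠ m in atTop, (P m).IsHomogeneous m ∧ (∃ x : E N, ‖x‖ = 1 ∧ polyEval (P m) x ≠ 0) ∧
      0 < κ m ∧ ψ m = mode (P m) (ν m) (κ m))
    (hκ : ∀ q : ℝ, 1 < q → ∀ᶠ m in atTop, κ m ≤ q * ν m) {τ : ℝ} (hτ : τ ∈ Ioo (0 : ℝ) 1) :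
    Localizes τ ψ := by
  obtain ⟨hτ0, hτ1⟩ := hτ
  -- `l > 1` serves both as the dilation and as the bound `κ_m ≤ l ν_m`; it is so close to `1` that
  -- the dilated argument `l κ_m |x| ≤ l² τ ν_m` stays below `ρ ν_m` with `ρ < 1`
  set l : ℝ := 1 + (1 - τ) / 4 with hl
  have hl1 : 1 < l := by rw [hl]; linarith
  have hl0 : 0 < l := by linarith
  set ρ : ℝ := l ^ 2 * τ with hρ
  have hρ0 : 0 < ρ := by positivity
  have hρ1 : ρ < 1 := by
    have h1 : l ^ 2 < 1 + (1 - τ) := by rw [hl]; nlinarith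
    have h2 : ρ < (1 + (1 - τ)) * τ := by rw [hρ]; gcongr
    nlinarith [sq_nonneg (1 - τ)]
  have hρ2 : 0 < 1 - ρ ^ 2 := by nlinarith
  set c : ℝ := Real.sqrt (1 - ρ ^ 2) with hc
  have hc0 : 0 < c := Real.sqrt_pos.2 hρ2
  have hc2 : c ^ 2 = 1 - ρ ^ 2 := Real.sq_sqrt hρ2.le
  have hνeq : ∀ m : ℕ, ν m = m + (N / 2 - 1) := fun m => by linarith [hν m]
  have hνt : Tendsto ν atTop atTop := by
    rw [funext hνeq]
    exact tendsto_atTop_add_const_right _ _ tendsto_natCast_atTop_atTop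
  have hexp : Tendsto (fun m => l ^ (c * ν m + 1 - N / 2 : ℝ)) atTop atTop := by
    have h1 : Tendsto (fun m => c * ν m + 1 - N / 2 : ℕ → ℝ) atTop atTop := by
      simp_rw [add_sub_assoc]
      exact tendsto_atTop_add_const_right _ _ (hνt.const_mul_atTop hc0)
    exact (tendsto_rpow_atTop_of_base_gt_one l hl1).comp h1
  refine localizes_of_dilation (l := l) hl1.le (by nlinarith) hexp ?_
  filter_upwards [h, hκ l hl1, hνt.eventually_ge_atTop 1, eventually_ge_atTop 1]
    with m ⟨hP, hP0, hκ0, hψ⟩ hκm hν1 hm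
  rw [hψ]
  refine ⟨(contDiff_mode _ (by linarith) _).continuous, exists_mode_ne_zero hP hP0 (by linarith) _,
    fun x hx => rpow_mul_norm_mode_le hP hm hν1 (hν m) hκ0 hl1.le ?_⟩
  have hxτ : ‖x‖ ≤ τ := (mem_ball_zero_iff.1 hx).le
  have h1 : l * (κ m * ‖x‖) ≤ ρ * ν m := by
    calc l * (κ m * ‖x‖) ≤ l * (l * ν m * τ) := by gcongr
      _ = ρ * ν m := by rw [hρ]; ring
  have h2 : (l * (κ m * ‖x‖)) ^ 2 ≤ (ρ * ν m) ^ 2 := by gcongr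
  rw [mul_pow] at h2
  rw [mul_pow c, hc2]
  linarith

/-! ### Families of transmission eigenfunctions -/

/-- The result in every dimension at once, for modes with radial amplitudes `R_m` proportional to
`t^{1 - N / 2} J_ν(t)`, `ν = m + N / 2 - 1`. -/
theorem exists_forall_mode_family (hN : 2 ≤ N) {n : ℝ} (hn : 0 < n) (hn1 : n ≠ 1) {ν : ℕ → ℝ}
    (hν : ∀ m : ℕ, ν m + 1 = m + N / 2) {c : ℝ} (hc : c ≠ 0) {R : ℕ → ℝ → ℝ}
    (hR : ∀ m t, 0 < t → R m t = c * (t / 2) ^ m * besselEntire (ν m) (t ^ 2 / 4)) (s : ℕ) :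
    ∃ m₀ : ℕ, (∀ m > m₀, ∃ k, IsModeZero n (ν m) (s + 1) k) ∧
      ∀ (k : ℕ → ℝ) (P : ℕ → MvPolynomial (Fin N) ℂ) (w v : ℕ → E N → ℂ),
        (∀ m > m₀, IsModeZero n (ν m) (s + 1) (k m)) →
        (∀ m > m₀, (P m).IsHomogeneous m ∧
          ∑ i, MvPolynomial.pderiv i (MvPolynomial.pderiv i (P m)) = 0 ∧
          ∃ x : E N, ‖x‖ = 1 ∧ polyEval (P m) x ≠ 0) →
        (∀ m > m₀, 0 < k m → w m = mode (MvPolynomial.C ((c * (k m * n / 2) ^ m : ℝ) : ℂ) * P m)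
          (ν m) (k m * n)) →
        (∀ m > m₀, 0 < k m → v m = mode (MvPolynomial.C
          ((R m (k m * n) / R m (k m) * (c * (k m / 2) ^ m) : ℝ) : ℂ) * P m) (ν m) (k m)) →
        (∀ m > m₀, IsEigenpair (Om N 1) n (k m) (w m) (v m)) ∧
        Tendsto k atTop atTop ∧
        ∀ τ ∈ Ioo (0 : ℝ) 1, Localizes τ w ∧ Localizes τ v := by
  have hM : 0 < max n 1 := by positivity
  have hNr : (2 : ℝ) ≤ N := by exact_mod_cast hN
  have hνm : ∀ m : ℕ, (m : ℝ) ≤ ν m := fun m => by linarith [hν m]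
  have hνt : Tendsto ν atTop atTop := tendsto_atTop_mono hνm tendsto_natCast_atTop_atTop
  obtain ⟨m₀, hm₀⟩ := eventually_atTop.1
    (hνt.eventually (eventually_besselZero_mul_le hn hn1 (s + 2)))
  have hν1 : ∀ m > m₀, 1 ≤ ν m := fun m hm =>
    le_trans (by exact_mod_cast (show 1 ≤ m by omega)) (hνm m)
  refine ⟨m₀, fun m hm => exists_isModeZero hn hn1 (hν1 m hm) s (hm₀ m hm.le),
    fun k P w v hk hP hw hv => ?_⟩
  have hk0 : ∀ m > m₀, 0 < k m := fun m hm => (hk m hm).pos (hν1 m hm)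
  have hR0 : ∀ m > m₀, R m (k m) ≠ 0 ∧ R m (k m * n) ≠ 0 := by
    intro m hm
    have hkm := hk0 m hm
    obtain ⟨h1, h2⟩ := (hk m hm).besselJ_ne_zero hn (hν1 m hm) (hm₀ m hm.le)
    rw [besselJ_eq (by positivity)] at h1 h2
    rw [hR m _ hkm, hR m _ (by positivity)]
    exact ⟨mul_ne_zero (mul_ne_zero hc (by positivity)) (right_ne_zero_of_mul h1),
      mul_ne_zero (mul_ne_zero hc (by positivity)) (right_ne_zero_of_mul h2)⟩
  have hlt : ∀ᶠ m in atTop, m > m₀ := eventually_gt_atTop m₀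
  refine ⟨fun m hm => ?_, ?_, fun τ hτ => ?_⟩
  · rw [hw m hm (hk0 m hm), hv m hm (hk0 m hm)]
    obtain ⟨h1, h2, h3⟩ := hP m hm
    exact isEigenpair_of_charFun_eq_zero h1 h2 h3 (hν1 m hm) (hν m) hn (hk0 m hm) hc (hR m)
      (hR0 m hm).1 rfl (hk m hm).2
  · refine tendsto_atTop_mono' atTop ?_ (hνt.atTop_div_const hM)
    filter_upwards [hlt] with m hm
    rw [div_le_iff₀ hM]
    exact ((lt_besselZero (hν1 m hm) s).trans (hk m hm).lt_mul_max).le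
  · have hq : ∀ q : ℝ, 1 < q → ∀ᶠ m in atTop, k m * max n 1 ≤ q * ν m := fun q hq => by
      filter_upwards [hlt, hνt.eventually (eventually_besselZero_lt (s + 2) hq)] with m hm hz
      exact ((hk m hm).mul_max_lt.trans hz).le
    have hC : ∀ (a : ℝ) (m : ℕ), a ≠ 0 → m > m₀ →
        (MvPolynomial.C (a : ℂ) * P m).IsHomogeneous m ∧
          ∃ x : E N, ‖x‖ = 1 ∧ polyEval (MvPolynomial.C (a : ℂ) * P m) x ≠ 0 := by
      intro a m ha hm
      obtain ⟨h1, -, x, hx, hx0⟩ := hP m hm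
      refine ⟨by simpa using (MvPolynomial.isHomogeneous_C (Fin N) (a : ℂ)).mul h1, x, hx, ?_⟩
      simpa [polyEval, ha] using hx0
    constructor
    · refine localizes_mode hν (κ := fun m => k m * n)
        (P := fun m => MvPolynomial.C ((c * (k m * n / 2) ^ m : ℝ) : ℂ) * P m) ?_
        (fun q h1 => ?_) hτ
      · filter_upwards [hlt] with m hm
        have hkm := hk0 m hm
        obtain ⟨h1, h2⟩ := hC (c * (k m * n / 2) ^ m) m (mul_ne_zero hc (by positivity)) hm
        exact ⟨h1, h2, by positivity, hw m hm hkm⟩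
      · filter_upwards [hq q h1, hlt] with m hm hm'
        exact (mul_le_mul_of_nonneg_left (le_max_left _ _) (hk0 m hm').le).trans hm
    · refine localizes_mode hν (κ := k) (P := fun m => MvPolynomial.C
        ((R m (k m * n) / R m (k m) * (c * (k m / 2) ^ m) : ℝ) : ℂ) * P m) ?_
        (fun q h1 => ?_) hτ
      · filter_upwards [hlt] with m hm
        have hkm := hk0 m hm
        obtain ⟨h1, h2⟩ := hC (R m (k m * n) / R m (k m) * (c * (k m / 2) ^ m)) m
          (mul_ne_zero (div_ne_zero (hR0 m hm).2 (hR0 m hm).1)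
            (mul_ne_zero hc (by positivity))) hm
        exact ⟨h1, h2, hkm, hv m hm hkm⟩
      · filter_upwards [hq q h1, hlt] with m hm hm'
        exact (le_mul_of_one_le_right (hk0 m hm').le (le_max_right _ _)).trans hm

/-- In the plane, `P = (x₀ + i x₁)^m`, `ν = m` and `R_m = J_m`. -/
theorem planar_family {n : ℝ} (hn : 0 < n) (hn1 : n ≠ 1) (s₀ : ℕ) (hs : 1 ≤ s₀) :
    ∃ m₀ : ℕ, (∀ m > m₀, ∃ k : ℝ, IsModeZero n m s₀ k) ∧
      ∀ k : ℕ → ℝ, (∀ m > m₀, IsModeZero n m s₀ (k m)) →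
        (∀ m > m₀, IsEigenpair (Om 2 1) n (k m) (w2 n m (k m)) (v2 n m (k m))) ∧
        Tendsto k atTop atTop ∧
        ∀ τ ∈ Ioo (0 : ℝ) 1, Localizes τ (fun m => w2 n m (k m)) ∧
          Localizes τ (fun m => v2 n m (k m)) := by
  obtain ⟨s, rfl⟩ := Nat.exists_eq_succ_of_ne_zero (show s₀ ≠ 0 by omega)
  obtain ⟨m₀, h1, h2⟩ := exists_forall_mode_family (N := 2) le_rfl hn hn1
    (ν := fun m => m) (fun m => by norm_num) (c := 1) one_ne_zero (R := fun m t => besselJ m t)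
    (fun m t ht => by rw [besselJ_eq ht, Real.rpow_natCast, one_mul]) s
  refine ⟨m₀, h1, fun k hk => h2 k planarHarmonic _ _ hk (fun m _ => ?_) (fun m hm hkm => ?_)
    (fun m hm hkm => ?_)⟩
  · refine ⟨isHomogeneous_isotropic_pow m, laplacian_planarHarmonic m,
      EuclideanSpace.single 0 1, by simp, ?_⟩
    simp [polyEval, planarHarmonic]
  · exact planarMode_eq_mode (by omega) (by positivity)
  · ext x
    rw [mode_C_mul, Complex.ofReal_mul, mul_assoc, ← mode_C_mul,
      ← planarMode_eq_mode (by omega) hkm]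
    rfl

/-- In space, `ν = m + 1 / 2` and `R_m = j_m`. -/
theorem spatial_family {n : ℝ} (hn : 0 < n) (hn1 : n ≠ 1) (s₀ : ℕ) (hs : 1 ≤ s₀) :
    ∃ m₀ : ℕ, (∀ m > m₀, ∃ k : ℝ, IsModeZero n (m + 1 / 2) s₀ k) ∧
      ∀ (k : ℕ → ℝ) (Y : ℕ → E 3 → ℂ), (∀ m > m₀, IsModeZero n (m + 1 / 2) s₀ (k m)) →
        (∀ m > m₀, IsSphericalHarmonic m (Y m) ∧
          ∃ x ∈ Metric.sphere (0 : E 3) 1, Y m x ≠ 0) →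
        (∀ m > m₀, IsEigenpair (Om 3 1) n (k m) (w3 n m (k m) (Y m)) (v3 n m (k m) (Y m))) ∧
        Tendsto k atTop atTop ∧
        ∀ τ ∈ Ioo (0 : ℝ) 1, Localizes τ (fun m => w3 n m (k m) (Y m)) ∧
          Localizes τ (fun m => v3 n m (k m) (Y m)) := by
  obtain ⟨s, rfl⟩ := Nat.exists_eq_succ_of_ne_zero (show s₀ ≠ 0 by omega)
  obtain ⟨m₀, h1, h2⟩ := exists_forall_mode_family (N := 3) (by norm_num) hn hn1
    (ν := fun m => m + 1 / 2) (fun m => by push_cast; ring) (c := Real.sqrt Real.pi / 2)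
    (by positivity) (R := sphericalBessel) (fun m t ht => sphericalBessel_eq ht) s
  refine ⟨m₀, h1, fun k Y hk hY => ?_⟩
  have hP : ∀ m, ∃ P : MvPolynomial (Fin 3) ℂ, m > m₀ → P.IsHomogeneous m ∧
      ∑ i, MvPolynomial.pderiv i (MvPolynomial.pderiv i P) = 0 ∧
      ∀ x ∈ Metric.sphere (0 : E 3) 1, Y m x = polyEval P x := by
    intro m
    by_cases hm : m > m₀
    · obtain ⟨⟨P, hP⟩, -⟩ := hY m hm
      exact ⟨P, fun _ => hP⟩
    · exact ⟨0, fun h => absurd h hm⟩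
  choose P hP using hP
  refine h2 k P _ _ hk (fun m hm => ?_) (fun m hm hkm => ?_) (fun m hm hkm => ?_)
  · obtain ⟨x, hx, hx0⟩ := (hY m hm).2
    exact ⟨(hP m hm).1, (hP m hm).2.1, x, mem_sphere_zero_iff_norm.1 hx,
      (hP m hm).2.2 x hx ▸ hx0⟩
  · exact spatialMode_eq_mode (by omega) (by positivity) (hP m hm).1 (hP m hm).2.2
  · ext x
    rw [mode_C_mul, Complex.ofReal_mul, mul_assoc, ← mode_C_mul,
      ← spatialMode_eq_mode (by omega) hkm (hP m hm).1 (hP m hm).2.2]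
    rfl

end Transmission

theorem theorem2p1 (n : ℝ) (hn : 0 < n) (hn1 : n ≠ 1) :
    -- existence of eigenfunctions `w_m`, `v_m` that are both localized at the boundary
    (∀ N : ℕ, N = 2 ∨ N = 3 → ∀ τ ∈ Set.Ioo (0 : ℝ) 1,
      ∃ (k : ℕ → ℝ) (w v : ℕ → Transmission.E N → ℂ),
        (∀ m, Transmission.IsEigenpair (Transmission.Om N 1) n (k m) (w m) (v m)) ∧
        Filter.Tendsto k Filter.atTop Filter.atTop ∧
        Transmission.Localizes τ w ∧ Transmission.Localizes τ v) ∧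
    -- the explicit planar modes
    (∀ s₀ : ℕ, 1 ≤ s₀ → ∃ m₀ : ℕ,
      (∀ m > m₀, ∃ k : ℝ, Transmission.IsModeZero n m s₀ k) ∧
      ∀ k : ℕ → ℝ, (∀ m > m₀, Transmission.IsModeZero n m s₀ (k m)) →
        (∀ m > m₀, Transmission.IsEigenpair (Transmission.Om 2 1) n (k m)
          (Transmission.w2 n m (k m)) (Transmission.v2 n m (k m))) ∧
        Filter.Tendsto k Filter.atTop Filter.atTop ∧
        ∀ τ ∈ Set.Ioo (0 : ℝ) 1,
          Transmission.Localizes τ (fun m => Transmission.w2 n m (k m)) ∧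
          Transmission.Localizes τ (fun m => Transmission.v2 n m (k m))) ∧
    -- the explicit spatial modes
    (∀ s₀ : ℕ, 1 ≤ s₀ → ∃ m₀ : ℕ,
      (∀ m > m₀, ∃ k : ℝ, Transmission.IsModeZero n (m + 1 / 2) s₀ k) ∧
      ∀ (k : ℕ → ℝ) (Y : ℕ → Transmission.E 3 → ℂ),
        (∀ m > m₀, Transmission.IsModeZero n (m + 1 / 2) s₀ (k m)) →
        (∀ m > m₀, Transmission.IsSphericalHarmonic m (Y m) ∧
          ∃ x ∈ Metric.sphere (0 : Transmission.E 3) 1, Y m x ≠ 0) →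
        (∀ m > m₀, Transmission.IsEigenpair (Transmission.Om 3 1) n (k m)
          (Transmission.w3 n m (k m) (Y m)) (Transmission.v3 n m (k m) (Y m))) ∧
        Filter.Tendsto k Filter.atTop Filter.atTop ∧
        ∀ τ ∈ Set.Ioo (0 : ℝ) 1,
          Transmission.Localizes τ (fun m => Transmission.w3 n m (k m) (Y m)) ∧
          Transmission.Localizes τ (fun m => Transmission.v3 n m (k m) (Y m))) := by

  refine ⟨?_, Transmission.planar_family hn hn1, Transmission.spatial_family hn hn1⟩
  rintro N (rfl | rfl) τ hτ
  · obtain ⟨m₀, hex, hfam⟩ := Transmission.planar_family hn hn1 1 le_rfl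
    have hex' : ∀ m : ℕ, ∃ k : ℝ, m > m₀ → Transmission.IsModeZero n m 1 k := fun m => by
      by_cases hm : m > m₀
      · exact (hex m hm).imp fun _ h _ => h
      · exact ⟨0, fun h => absurd h hm⟩
    choose k hk using hex'
    obtain ⟨h1, h2, h3⟩ := hfam k hk
    exact ⟨fun m => k (m + (m₀ + 1)), _, _, fun m => h1 _ (by omega),
      h2.comp (tendsto_add_atTop_nat _), (h3 τ hτ).1.comp_add (m₀ + 1),
      (h3 τ hτ).2.comp_add (m₀ + 1)⟩
  · obtain ⟨m₀, hex, hfam⟩ := Transmission.spatial_family hn hn1 1 le_rfl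
    have hex' : ∀ m : ℕ, ∃ k : ℝ, m > m₀ → Transmission.IsModeZero n (m + 1 / 2) 1 k := fun m => by
      by_cases hm : m > m₀
      · exact (hex m hm).imp fun _ h _ => h
      · exact ⟨0, fun h => absurd h hm⟩
    choose k hk using hex'
    obtain ⟨h1, h2, h3⟩ := hfam k
      (fun m => Transmission.polyEval (Transmission.sectorialHarmonic m)) hk fun m _ => ⟨⟨Transmission.sectorialHarmonic m,
        Transmission.isHomogeneous_isotropic_pow m, Transmission.laplacian_sectorialHarmonic m,
        fun _ _ => rfl⟩, EuclideanSpace.single 0 1, by simp, by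
          simp [Transmission.polyEval, Transmission.sectorialHarmonic]⟩
    exact ⟨fun m => k (m + (m₀ + 1)), _, _, fun m => h1 _ (by omega),
      h2.comp (tendsto_add_atTop_nat _), (h3 τ hτ).1.comp_add (m₀ + 1),
      (h3 τ hτ).2.comp_add (m₀ + 1)⟩
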